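/- **Notation.** For a partition $\lambda$ (identified with its Young diagram), a set-valued tableau of shape $\lambda$ is a filling of the boxes with finite non-empty sets of positive integers such that the largest integer in a box is at most the smallest integer in the box to its right, and strictly smaller than the smallest integer in the box below it. Let $x^T$ be the monomial in which the exponent of $x_i$ is the number of boxes of $T$ containing $i$, and $|T|$ its degree. Put $\mathcal G_\lambda(x_1,\dots,x_p)=\sum_T(-1)^{|T|-|\lambda|}x^T$, the sum over set-valued tableaux of shape $\lambda$ with entries in $\{1,\dots,p\}$; this polynomial is symmetric. Let $w(T)$ be the word of $T$ (rows read from bottom to top, each from left to right, integers in a box in increasing order), and $u(\mu)=(l^{\mu_l},\dots,2^{\mu_2},1^{\mu_1})$ for $\mu=(\mu_1,\dots,\mu_l)$. A word is a reverse lattice word if each occurrence of an integer $i\ge 2$ is followed by more occurrences of $i-1$ than of $i$; its content is $\nu=(\nu_1,\nu_2,\dots)$, where $\nu_i$ is the number of occurrences of $i$. Let $c^\nu_{\lambda\mu}$ be $(-1)^{|\nu|-|\lambda|-|\mu|}$ times the number of set-valued tableaux $T$ of shape $\lambda$ such that $w(T)u(\mu)$ is a reverse lattice word with content $\nu$. For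 $\lambda,\mu$ contained in a rectangle $R$ let $d^\nu_{\lambda\mu}=c^{\rho}_{R\nu}$, where $\rho=(R+\mu,\lambda)$ is obtained by attaching $\mu$ to the right side and $\lambda$ to the bottom side of $R$; this is independent of $R$, and zero unless $\lambda,\mu\subset\nu$. Let $Q$ be a finite quiver with vertex set $Q_0=\{1,\dots,n\}$, where an arrow $a$ has tail $t(a)$ and head $h(a)$. Let $e=(e_1,\dots,e_n)\in\mathbb N^n$, let $\Bbbk$ be a field, $E_i=\Bbbk^{e_i}$, $\mathbb G=\prod_i \mathrm{GL}(E_i)$, and $M_i=\bigoplus_{a\,:\,h(a)=i}E_{t(a)}$. Let $\mathbb T\subset\mathbb G$ be the torus of diagonal matrices, $E_i=L^i_1\oplus\dots\oplus L^i_{e_i}$ the corresponding decomposition, $\mathrm{Rep}(\mathbb T)=\mathbb Z[[L^i_j]^{\pm1}]$, and let $\mathrm{Rep}(\mathbb G)\subset\mathrm{Rep}(\mathbb T)$ be the ring of virtual rational representations of $\mathbb G$, included by restriction to $\mathbb T$. Regard $\mathrm{Rep}(\mathbb T)$ as a subring of the power series ring $\mathbb Z[\![x^i_j]\!]$, $1\le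 i\le n$, $1\le j\le e_i$, through $[L^i_j]=(1-x^i_j)^{-1}$, that is, $x^i_j=1-[L^i_j]^{-1}$. For a representation $U$ of $\mathbb G$ which is the direct sum of one-dimensional representations $L_1,\dots,L_u$ of $\mathbb T$, let $\mathcal G_\nu(U)=\mathcal G_\nu(1-[L_1]^{-1},\dots,1-[L_u]^{-1})$, and let $$\mathcal G_\nu(U_1-U_2)=\sum_{\lambda,\mu}d^\nu_{\lambda\mu}\,\mathcal G_\lambda(U_1)\,\mathcal G_{\mu'}(U_2^\vee),$$ where $\mu'$ is the conjugate partition and $U_2^\vee$ the dual representation. **Proposition 3.1.** Suppose that $Q$ has no oriented loops (no oriented cycles). Then for every $\alpha\in\mathrm{Rep}(\mathbb G)$ there is a unique family of integers $c_\mu$, indexed by the sequences $\mu=(\mu_1,\dots,\mu_n)$ of partitions with $\ell(\mu_i)\le e_i$ for each $i$, such that $$\alpha=\sum_\mu c_\mu\,\mathcal G_{\mu_1}(E_1-M_1)\,\mathcal G_{\mu_2}(E_2-M_2)\cdots\mathcal G_{\mu_n}(E_n-M_n).$$ The sum is possibly infinite and is taken in $\mathbb Z[\![x^i_j]\!]$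 with its usual topology, in which a sum converges when the coefficients of each monomial are eventually constant. -/

import Mathlib

open scoped MvPowerSeries.WithPiTopology

noncomputable section

namespace QuiverCoeff

universe u v w

/-! ## Set-valued tableaux and stable Grothendieck polynomials

A partition is identified with its Young diagram. Rows, columns and letters are numbered
from `0`, so the letter `k` below stands for the positive integer `k + 1`. -/

/-- A filling of the boxes of `μ` with finite sets is a set-valued tableau if all the sets are
non-empty, rows are weakly increasing and columns are strictly increasing. -/
def IsSetValuedTableau (μ : YoungDiagram) {α : Type*} [LinearOrder α]
    (T : μ.cells → Finset α) : Prop :=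
  (∀ c, (T c).Nonempty) ∧
  (∀ c d : μ.cells, d.1 = (c.1.1, c.1.2 + 1) → ∀ a ∈ T c, ∀ b ∈ T d, a ≤ b) ∧
  (∀ c d : μ.cells, d.1 = (c.1.1 + 1, c.1.2) → ∀ a ∈ T c, ∀ b ∈ T d, a < b)

/-- The degree `|T|`: the total number of letters in the boxes of `T`. -/
def degree {μ : YoungDiagram} {α : Type*} (T : μ.cells → Finset α) : ℕ :=
  ∑ c, (T c).card

open Classical in
/-- The value `𝒢_μ(a_1, …, a_p)` of the stable Grothendieck polynomial at a finite sequence of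
elements of a commutative ring: the sum of `(-1)^{|T| - |μ|} a^T` over all set-valued tableaux
`T` of shape `μ` with letters in `{1, …, p}` (the tableaux with other letters contribute `0`,
as the remaining variables are set to zero). -/
def stableGroth {R : Type*} [CommRing R] (μ : YoungDiagram) {p : ℕ} (a : Fin p → R) : R :=
  ∑ T : μ.cells → Finset (Fin p) with IsSetValuedTableau μ T,
    (-1) ^ (degree T - μ.card) * ∏ c, ∏ k ∈ T c, a k

/-! ## The structure constants of the product and of the coproduct -/

/-- The contents of the box in position `(i, j)`, and the empty set outside the diagram. -/
def box {μ : YoungDiagram} {α : Type*} (T : μ.cells → Finset α) (i j : ℕ) : Finset α :=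
  if h : (i, j) ∈ μ.cells then T ⟨(i, j), h⟩ else ∅

/-- The word `w(T)`: rows are read from bottom to top, each row from left to right, and the
letters of a box in increasing order. -/
def word {μ : YoungDiagram} (T : μ.cells → Finset ℕ) : List ℕ :=
  (List.range (μ.colLen 0)).reverse.flatMap fun i =>
    (List.range (μ.rowLen i)).flatMap fun j => (box T i j).sort (· ≤ ·)

/-- The word `u(μ) = (l^{μ_l}, …, 2^{μ_2}, 1^{μ_1})`. -/
def canonicalWord (μ : YoungDiagram) : List ℕ :=
  (List.range (μ.colLen 0)).reverse.flatMap fun i => List.replicate (μ.rowLen i) i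

/-- Every occurrence of a letter that is not the smallest one is followed by more occurrences
of the preceding letter than of the letter itself. -/
def IsReverseLattice (l : List ℕ) : Prop :=
  ∀ (l₁ l₂ : List ℕ) (k : ℕ), l = l₁ ++ (k + 1) :: l₂ → l₂.count (k + 1) < l₂.count k

/-- The word `l` has content `ν`. -/
def HasContent (l : List ℕ) (ν : YoungDiagram) : Prop :=
  ∀ k, l.count k = ν.rowLen k

/-- The structure constant `c^ν_{λμ}` of the product of stable Grothendieck polynomials:
`(-1)^{|ν| - |λ| - |μ|}` times the number of set-valued tableaux `T` of shape `λ` such that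
`w(T) u(μ)` is a reverse lattice word with content `ν`.
(If such a `T` exists then `|λ| + |μ| ≤ |ν|`.) -/
def prodCoeff (lam μ ν : YoungDiagram) : ℤ :=
  (-1) ^ (ν.card - lam.card - μ.card) *
    (Nat.card {T : lam.cells → Finset ℕ // IsSetValuedTableau lam T ∧
      IsReverseLattice (word T ++ canonicalWord μ) ∧
      HasContent (word T ++ canonicalWord μ) ν} : ℤ)

/-- The rectangular partition with `p` rows and `q` columns. -/
def rect (p q : ℕ) : YoungDiagram where
  cells := Finset.range p ×ˢ Finset.range q
  isLowerSet := by
    rintro ⟨a, b⟩ ⟨c, d⟩ h hab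
    have h1 : c ≤ a := h.1
    have h2 : d ≤ b := h.2
    simp only [Finset.coe_product, Finset.coe_range, Set.mem_prod, Set.mem_Iio] at hab ⊢
    omega

theorem mem_rect {p q i j : ℕ} : (i, j) ∈ rect p q ↔ i < p ∧ j < q := by
  rw [← YoungDiagram.mem_cells]
  simp [rect]

/-- The partition `(R + μ, λ)` obtained from the `p × q` rectangle `R` by attaching `μ` to its
right side and `λ` to its bottom side. -/
def attach (p q : ℕ) (lam μ : YoungDiagram) (hl : lam ≤ rect p q) (hm : μ ≤ rect p q) :
    YoungDiagram where
  cells := (rect p q).cells ∪ μ.cells.image (fun c => (c.1, q + c.2)) ∪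
    lam.cells.image (fun c => (p + c.1, c.2))
  isLowerSet := by
    rintro ⟨a, b⟩ ⟨c, d⟩ h hab
    have h1 : c ≤ a := h.1
    have h2 : d ≤ b := h.2
    simp only [Finset.coe_union, Finset.coe_image, Set.mem_union, Set.mem_image, Finset.mem_coe,
      Prod.exists, YoungDiagram.mem_cells, Prod.mk.injEq, mem_rect] at hab ⊢
    rcases hab with (hab | ⟨x, y, hxy, rfl, rfl⟩) | ⟨x, y, hxy, rfl, rfl⟩
    · left; left; omega
    · have hx := mem_rect.1 (hm hxy)
      by_cases hd : d < q
      · left; left; omega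
      · left; right
        exact ⟨c, d - q, μ.up_left_mem h1 (by omega) hxy, rfl, by omega⟩
    · have hx := mem_rect.1 (hl hxy)
      by_cases hc : c < p
      · left; left; omega
      · right
        exact ⟨c - p, d, lam.up_left_mem (by omega) h2 hxy, by omega, rfl⟩

/-- The coefficient `d^ν_{λμ} = c^ρ_{Rν}`, where `R` is the `p × q` rectangle and
`ρ = (R + μ, λ)`. It does not depend on the rectangle `R` that contains `λ` and `μ`. -/
def coprodCoeff (p q : ℕ) (ν lam μ : YoungDiagram) (hl : lam ≤ rect p q) (hm : μ ≤ rect p q) :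
    ℤ :=
  prodCoeff (rect p q) ν (attach p q lam μ hl hm)

/-- A partition is contained in the rectangle spanned by its first column and first row. -/
theorem le_rect (ν : YoungDiagram) : ν ≤ rect (ν.colLen 0) (ν.rowLen 0) := by
  rintro ⟨i, j⟩ h
  exact mem_rect.2 ⟨YoungDiagram.mem_iff_lt_colLen.1 (ν.up_left_mem le_rfl (Nat.zero_le _) h),
    YoungDiagram.mem_iff_lt_rowLen.1 (ν.up_left_mem (Nat.zero_le _) le_rfl h)⟩

instance finite_Iic (ν : YoungDiagram) : Finite (Set.Iic ν) := by
  refine Finite.of_injective (β := Set.Iic ν.cells)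
    (fun x => ⟨x.1.cells, YoungDiagram.cells_subset_iff.2 x.2⟩) ?_
  intro x y h
  exact Subtype.ext (YoungDiagram.ext (congrArg Subtype.val h))

instance fintype_Iic (ν : YoungDiagram) : Fintype (Set.Iic ν) := Fintype.ofFinite _

/-! ## The representation rings

`Σ i, Fin (e i)` indexes the one-dimensional summands `L^i_j` of `E_i = k^{e_i}`. -/

section Torus

variable {Q₀ : Type v} (e : Q₀ → ℕ)

/-- The characters of the maximal torus `𝕋`: the function `χ` stands for
`⨂_{i,j} (L^i_j)^{χ(i,j)}`. -/
abbrev Weight : Type v := (Σ i, Fin (e i)) → ℤ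

/-- `Rep(𝕋)`, the ring of Laurent polynomials in the `[L^i_j]` with integer coefficients. -/
abbrev RepT : Type v := AddMonoidAlgebra ℤ (Weight e)

variable {e}

/-- The class in `Rep(𝕋)` of the one-dimensional representation with character `χ`. -/
def line (χ : Weight e) : RepT e := AddMonoidAlgebra.single χ 1

/-- `𝒢_ν(U) = 𝒢_ν(1 - [L_1]⁻¹, …, 1 - [L_u]⁻¹)` for `U = L_1 ⊕ ⋯ ⊕ L_u`, where `U` is given by
the characters of its one-dimensional summands. -/
def grothRep (ν : YoungDiagram) {p : ℕ} (U : Fin p → Weight e) : RepT e :=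
  stableGroth ν fun m => 1 - line (-U m)

/-- `𝒢_ν(U₁ - U₂) = ∑ d^ν_{λμ} 𝒢_λ(U₁) 𝒢_{μ'}(U₂^∨)`. As `d^ν_{λμ} = 0` unless `λ` and `μ` are
contained in `ν`, the sum is over such `λ` and `μ`; all of these fit inside the rectangle
spanned by the first column and the first row of `ν`. -/
def grothDiff (ν : YoungDiagram) {p q : ℕ} (U₁ : Fin p → Weight e) (U₂ : Fin q → Weight e) :
    RepT e :=
  ∑ lam : Set.Iic ν, ∑ μ : Set.Iic ν,
    coprodCoeff (ν.colLen 0) (ν.rowLen 0) ν lam μ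
        (le_trans lam.2 (le_rect ν)) (le_trans μ.2 (le_rect ν)) •
      (grothRep lam.1 U₁ * grothRep μ.1.transpose fun m => -U₂ m)

/-- The power series `1 - x^i_j`, which represents `[L^i_j]⁻¹`, as a unit. -/
def oneSubX (s : Σ i, Fin (e i)) : (MvPowerSeries (Σ i, Fin (e i)) ℤ)ˣ :=
  IsUnit.unit (a := 1 - MvPowerSeries.X s) (by
    rw [MvPowerSeries.isUnit_iff_constantCoeff]; simp)

variable [Fintype Q₀]

/-- The homomorphism `Rep(𝕋) → ℤ⟦x^i_j⟧` with `[L^i_j] ↦ (1 - x^i_j)⁻¹ = ∑_p (x^i_j)^p`. -/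
def toPowerSeries : RepT e →+* MvPowerSeries (Σ i, Fin (e i)) ℤ :=
  (AddMonoidAlgebra.lift ℤ (MvPowerSeries (Σ i, Fin (e i)) ℤ) (Weight e)
    { toFun := fun χ => ((∏ s, oneSubX s ^ (-(Multiplicative.toAdd χ s)) :
        (MvPowerSeries (Σ i, Fin (e i)) ℤ)ˣ) : MvPowerSeries (Σ i, Fin (e i)) ℤ)
      map_one' := by simp
      map_mul' := fun χ ψ => by
        rw [← Units.val_mul, ← Finset.prod_mul_distrib]
        simp only [toAdd_mul, Pi.add_apply, neg_add, zpow_add] }).toRingHom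

end Torus

section Group

variable (k : Type u) [Field k] {Q₀ : Type v} (e : Q₀ → ℕ)

/-- A rational representation of `𝔾 = ∏ GL(E_i)`, `E_i = k^{e_i}`, on `k^N`: a morphism of
algebraic groups `𝔾 → GL_N` over `k`, given as a homomorphism on points with values in
every commutative `k`-algebra, natural in the algebra. -/
structure RationalRep (N : ℕ) where
  /-- the homomorphism on `A`-valued points -/
  hom : ∀ (A : Type u) [CommRing A] [Algebra k A],
    (∀ i, GL (Fin (e i)) A) →* GL (Fin N) A
  natural : ∀ (A B : Type u) [CommRing A] [Algebra k A] [CommRing B] [Algebra k B]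
    (f : A →ₐ[k] B) (g : ∀ i, GL (Fin (e i)) A),
    hom B (fun i => Matrix.GeneralLinearGroup.map (f : A →+* B) (g i)) =
      Matrix.GeneralLinearGroup.map (f : A →+* B) (hom A g)

/-- The invertible diagonal matrix with the given units on the diagonal. -/
def diagUnits {n : Type*} [Fintype n] [DecidableEq n] {A : Type*} [CommRing A] (t : n → Aˣ) :
    GL n A :=
  Units.map (Matrix.diagonalRingHom n A).toMonoidHom (MulEquiv.piUnits.symm t)

variable {k e} [Fintype Q₀]

/-- The restriction of `ρ` to the maximal torus of diagonal matrices is a direct sum of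
one-dimensional representations with characters `χ 0, …, χ (N - 1)`: after a change of basis of
`k^N`, a point `t` of the torus acts by the diagonal matrix with entries
`∏_{i,j} (t^i_j)^{χ_m(i,j)}`. -/
def HasWeights {N : ℕ} (ρ : RationalRep k e N) (χ : Fin N → Weight e) : Prop :=
  ∃ P : GL (Fin N) k, ∀ (A : Type u) [CommRing A] [Algebra k A] (t : (Σ i, Fin (e i)) → Aˣ),
    Matrix.GeneralLinearGroup.map (algebraMap k A) P *
        ρ.hom A (fun i => diagUnits fun j => t ⟨i, j⟩) *
        (Matrix.GeneralLinearGroup.map (algebraMap k A) P)⁻¹ =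
      diagUnits fun m => ∏ s, t s ^ χ m s

variable (k e)

/-- `Rep(𝔾) ⊂ Rep(𝕋)`: the group of virtual representations of `𝔾`, that is, the integral
linear combinations of classes of rational representations of `𝔾`, each one regarded as an
element of `Rep(𝕋)` by restriction to the maximal torus `𝕋`. -/
def RepG : AddSubgroup (RepT e) :=
  AddSubgroup.closure {α | ∃ (N : ℕ) (ρ : RationalRep k e N) (χ : Fin N → Weight e),
    HasWeights ρ χ ∧ α = ∑ m, line (χ m)}

end Group

section Quiver

variable {Q₀ : Type v} (e : Q₀ → ℕ)

open Classical in
/-- The characters of the summands of `E_i = L^i_1 ⊕ ⋯ ⊕ L^i_{e_i}`. -/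
def vertexRep (i : Q₀) : Fin (e i) → Weight e := fun j => Pi.single ⟨i, j⟩ 1

variable [Fintype Q₀] [Quiver.{w} Q₀] [∀ i j : Q₀, Fintype (i ⟶ j)]

/-- The one-dimensional summands of `M_i = ⨁_{a : h(a) = i} E_{t(a)}`: an arrow `a : j ⟶ i`
together with a summand of `E_j`. -/
abbrev TailIndex (i : Q₀) : Type (max v w) := Σ j : Q₀, (j ⟶ i) × Fin (e j)

/-- The characters of the summands of `M_i`, listed in an arbitrary order (which does not
matter, as stable Grothendieck polynomials are symmetric). -/
def tailRep (i : Q₀) : Fin (Fintype.card (TailIndex e i)) → Weight e := fun m =>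
  let s := (Fintype.equivFin (TailIndex e i)).symm m
  vertexRep e s.1 s.2.2

end Quiver

end QuiverCoeff

end

open QuiverCoeff

/-!
The proof is a triangularity argument in the ring of power series, for a suitable weighting of the
variables.

Give `x^i_j` the weight `d i * E + j + 1`, where `d i` is the number of vertices that can be reached
from `i` and `E` is the sum of the dimensions. As the quiver has no oriented cycles, `d` is larger
at the tail of an arrow than at its head (`card_reachable_lt`), so all variables at the tail have
larger weight than those at the head. For these weights the product of the `𝒢_{μ_i}(E_i - M_i)` is
the monomial `∏ (x^i_j)^{μ_{i,j}}` with coefficient `1` plus terms of larger weight: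

* In `𝒢_μ(E_i)` the tableau with the letter `i` in all boxes of row `i` is the only one of least
  weight (`hasLowestTerm_stableGroth`).
* A term `d^ν_{λμ} 𝒢_λ(E_i) 𝒢_{μ'}(M_i^∨)` of `𝒢_ν(E_i - M_i)` is nonzero only if `λ, μ ⊆ ν` and
  `|λ| + |μ| ≥ |ν|` (`card_le_of_coprodCoeff_ne_zero`). Trading boxes of `ν / λ` for variables of
  `M_i^∨` increases the weight, unless `μ` is empty; then `λ = ν`, and `d^ν_{ν∅} = 1`
  (`coprodCoeff_self_bot`). See `hasLowestTerm_grothDiff`.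

So the coefficients at the exponents that come from families of partitions form a unitriangular
system for the `c_μ`, in which finitely many unknowns have weight below any bound; it has exactly
one solution (`existsUnique_hasSum_smul`). The sum with these coefficients is equal to `α`, since
both are invariant under the Weyl group `∏ S_{e_i}` and every exponent is conjugate to one that
comes from partitions (`exists_eq_embDomain_familyExponent`). The invariance rests on two facts:

* Stable Grothendieck polynomials are symmetric (`stableGroth_comp_perm`). Splitting off the largest
  letter writes them as products of transfer matrices between Young diagrams
  (`stableGroth_succ`), and the matrices of two letters commute: the entries of their product factor
  over the rows, and after moving the asymmetric factors to neighbouring rows each row contributes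
  a symmetric polynomial (`prod_rowTransfer_comm`).
* The weights of a representation of `𝔾` are permuted by the Weyl group, because permutation
  matrices conjugate the points of the torus (`weights_invariant`).
-/

namespace QuiverCoeff

universe u v w

/-! ### Young diagrams and their row lengths -/

theorem eq_of_rowLen_eq {μ ν : YoungDiagram} (h : ∀ i, μ.rowLen i = ν.rowLen i) : μ = ν := by
  ext ⟨i, j⟩
  rw [YoungDiagram.mem_cells, YoungDiagram.mem_cells, YoungDiagram.mem_iff_lt_rowLen,
    YoungDiagram.mem_iff_lt_rowLen, h]

theorem le_iff_rowLen_le {μ ν : YoungDiagram} : μ ≤ ν ↔ ∀ i, μ.rowLen i ≤ ν.rowLen i := by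
  constructor
  · intro h i
    by_contra! hlt
    exact lt_irrefl _ (YoungDiagram.mem_iff_lt_rowLen.1 (h (YoungDiagram.mem_iff_lt_rowLen.2 hlt)))
  · rintro h ⟨i, j⟩ hij
    exact YoungDiagram.mem_iff_lt_rowLen.2 ((YoungDiagram.mem_iff_lt_rowLen.1 hij).trans_le (h i))

theorem rowLen_eq_zero_iff {μ : YoungDiagram} {i : ℕ} : μ.rowLen i = 0 ↔ μ.colLen 0 ≤ i := by
  rw [← not_iff_not, ← ne_eq, ← Nat.pos_iff_ne_zero, ← YoungDiagram.mem_iff_lt_rowLen,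
    YoungDiagram.mem_iff_lt_colLen, not_le]

theorem colLen_zero_mono {μ ν : YoungDiagram} (h : μ ≤ ν) : μ.colLen 0 ≤ ν.colLen 0 := by
  rw [← rowLen_eq_zero_iff, ← Nat.le_zero]
  exact (le_iff_rowLen_le.1 h _).trans (rowLen_eq_zero_iff.2 le_rfl).le

/-- The Young diagram with row lengths `f 0 ≥ ⋯ ≥ f (N - 1)`. -/
def diagramOfRows (f : ℕ → ℕ) (hf : Antitone f) (N : ℕ) : YoungDiagram where
  cells := (Finset.range N).sigma (fun i => Finset.range (f i)) |>.map
    (Equiv.sigmaEquivProd ℕ ℕ).toEmbedding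
  isLowerSet := by
    rintro ⟨a, b⟩ ⟨c, d⟩ ⟨h1, h2⟩ hab
    simp only [Finset.coe_map, Set.mem_image, Finset.mem_coe, Finset.mem_sigma, Finset.mem_range,
      Sigma.exists, Equiv.coe_toEmbedding, Equiv.sigmaEquivProd_apply, Prod.mk.injEq] at hab ⊢
    obtain ⟨_, _, ⟨ha, hb⟩, rfl, rfl⟩ := hab
    simp only at h1 h2 hb
    have := hf h1
    exact ⟨c, d, ⟨by omega, by omega⟩, rfl, rfl⟩

theorem mem_diagramOfRows {f : ℕ → ℕ} (hf : Antitone f) {N : ℕ} (hN : ∀ i, N ≤ i → f i = 0)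
    {i j : ℕ} : (i, j) ∈ diagramOfRows f hf N ↔ j < f i := by
  rw [← YoungDiagram.mem_cells]
  simp only [diagramOfRows, Finset.mem_map, Finset.mem_sigma, Finset.mem_range,
      Sigma.exists, Equiv.coe_toEmbedding, Equiv.sigmaEquivProd_apply, Prod.mk.injEq]
  constructor
  · rintro ⟨_, _, ⟨ha, hb⟩, rfl, rfl⟩
    exact hb
  · intro h
    refine ⟨i, j, ⟨?_, h⟩, rfl, rfl⟩
    by_contra! hi
    rw [hN i hi] at h
    omega

theorem rowLen_diagramOfRows {f : ℕ → ℕ} (hf : Antitone f) {N : ℕ} (hN : ∀ i, N ≤ i → f i = 0)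
    (i : ℕ) : (diagramOfRows f hf N).rowLen i = f i := by
  refine le_antisymm ?_ ?_ <;> by_contra! h
  · exact lt_irrefl _ ((mem_diagramOfRows hf hN).1 (YoungDiagram.mem_iff_lt_rowLen.2 h))
  · exact lt_irrefl _ (YoungDiagram.mem_iff_lt_rowLen.1 ((mem_diagramOfRows hf hN).2 h))

/-- A sum over the boxes of a diagram, row by row. -/
theorem sum_cells {M : Type*} [AddCommMonoid M] (μ : YoungDiagram) {N : ℕ} (hN : μ.colLen 0 ≤ N)
    (f : ℕ × ℕ → M) :
    ∑ c ∈ μ.cells, f c = ∑ i ∈ Finset.range N, ∑ j ∈ Finset.range (μ.rowLen i), f (i, j) := by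
  rw [Finset.sum_sigma']
  refine Finset.sum_nbij' (fun c => ⟨c.1, c.2⟩) (fun c => (c.1, c.2)) ?_ ?_ ?_ ?_ ?_
  · rintro ⟨i, j⟩ h
    have h' := YoungDiagram.mem_iff_lt_rowLen.1 h
    simp only [Finset.mem_sigma, Finset.mem_range]
    refine ⟨?_, h'⟩
    by_contra! hi
    rw [rowLen_eq_zero_iff.2 (hN.trans hi)] at h'
    omega
  · rintro ⟨i, j⟩ h
    simp only [Finset.mem_sigma, Finset.mem_range] at h
    exact YoungDiagram.mem_iff_lt_rowLen.2 h.2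
  all_goals simp

theorem card_eq_sum_rowLen (μ : YoungDiagram) {N : ℕ} (hN : μ.colLen 0 ≤ N) :
    μ.card = ∑ i ∈ Finset.range N, μ.rowLen i := by
  have := sum_cells μ hN (fun _ => 1)
  simpa using this

/-! ### Commuting transfer matrices -/

section Transfer

variable {R : Type*} [CommRing R]

/-- The factor by which a letter with value `x` enters a row: `m < n` says that a removable box
may hold the letter in addition to smaller ones. -/
def cornerFactor (x : R) (m n : ℕ) : R := if m < n then 1 - x else 1

/-- The two-letter sum over one row, normalized so that it is symmetric in `x` and `y`. The
conditions `f` and `g` say that the factor `1 - x`, respectively `1 - y`, is present except at the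
lower, respectively upper, end of the range of summation; otherwise there is no such factor. -/
def rowSum (f g : Prop) [Decidable f] [Decidable g] (n : ℕ) (x y : R) : R :=
  ∑ k ∈ Finset.range (n + 1), x ^ (n - k) * y ^ k * (if f ∧ 0 < k then 1 - x else 1) *
    (if g ∧ k < n then 1 - y else 1)

theorem sum_pow_mul_pow_comm (n : ℕ) (x y : R) :
    ∑ k ∈ Finset.range (n + 1), x ^ (n - k) * y ^ k =
      ∑ k ∈ Finset.range (n + 1), y ^ (n - k) * x ^ k := by
  rw [← Finset.sum_range_reflect]
  refine Finset.sum_congr rfl fun k hk => ?_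
  rw [Finset.mem_range] at hk
  rw [show n - (n + 1 - 1 - k) = k by omega, show n + 1 - 1 - k = n - k by omega, mul_comm]

/-- Reflecting the range of summation proves the symmetry when `f` and `g` agree. When only one of
them holds, the sum is `h_n - x y h_{n-1}`, where `h_n` is the complete symmetric polynomial of
degree `n` in `x` and `y`. -/
theorem rowSum_comm (f g : Prop) [Decidable f] [Decidable g] (n : ℕ) (x y : R) :
    rowSum f g n x y = rowSum f g n y x := by
  have key : ∀ x y : R, ∑ k ∈ Finset.range (n + 1), x ^ (n - k) * y ^ k *
      (if 0 < k then 1 - x else 1) = ∑ k ∈ Finset.range (n + 1), x ^ (n - k) * y ^ k -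
        x * y * ∑ k ∈ Finset.range n, x ^ (n - 1 - k) * y ^ k := by
    intro x y
    rw [Finset.sum_range_succ', Finset.sum_range_succ' (fun k => x ^ (n - k) * y ^ k),
      Finset.mul_sum]
    simp only [Nat.succ_pos, if_true, lt_irrefl, if_false]
    rw [add_sub_right_comm, ← Finset.sum_sub_distrib]
    congr 1
    · refine Finset.sum_congr rfl fun k hk => ?_
      rw [show n - (k + 1) = n - 1 - k by omega]
      ring
    · ring
  have key' : ∀ x y : R, ∑ k ∈ Finset.range (n + 1), x ^ (n - k) * y ^ k *
      (if k < n then 1 - y else 1) = ∑ k ∈ Finset.range (n + 1), y ^ (n - k) * x ^ k *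
      (if 0 < k then 1 - y else 1) := by
    intro x y
    rw [← Finset.sum_range_reflect]
    refine Finset.sum_congr rfl fun k hk => ?_
    rw [Finset.mem_range] at hk
    rw [show n - (n + 1 - 1 - k) = k by omega, show n + 1 - 1 - k = n - k by omega,
      mul_comm (x ^ k)]
    congr 1
    exact if_congr (by omega) rfl rfl
  have key2 : ∀ x y : R, ∑ k ∈ Finset.range (n + 1), x ^ (n - k) * y ^ k *
      (if 0 < k then 1 - x else 1) = ∑ k ∈ Finset.range (n + 1), y ^ (n - k) * x ^ k *
      (if 0 < k then 1 - y else 1) := by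
    intro x y
    rw [key, key, sum_pow_mul_pow_comm, mul_comm x y]
    rcases n with _ | n
    · simp
    · simp only [Nat.add_sub_cancel, sum_pow_mul_pow_comm n x y]
  unfold rowSum
  by_cases hf : f <;> by_cases hg : g <;> simp only [hf, hg, true_and, false_and, if_false, mul_one]
  · rw [← Finset.sum_range_reflect]
    refine Finset.sum_congr rfl fun k hk => ?_
    rw [Finset.mem_range] at hk
    rw [show n - (n + 1 - 1 - k) = k by omega, show n + 1 - 1 - k = n - k by omega,
      if_congr (show 0 < n - k ↔ k < n by omega) rfl rfl,
      if_congr (show n - k < n ↔ 0 < k by omega) rfl rfl]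
    ring
  · exact key2 x y
  · rw [key', key', key2]
  · exact sum_pow_mul_pow_comm n x y

/-- The part of a two-letter row sum that comes from comparing a row length `p` of the outer
diagram with the length `q` of the preceding row of the inner diagram. -/
def edgeFactor (p q : ℕ) (x y : R) : R := x ^ (p - q) * cornerFactor y p q

/-- The sum over the length `m` of a row of the intermediate diagram splits off the two
contributions that are not symmetric in `x` and `y`. -/
theorem sum_row_eq (A B C D : ℕ) (h : max A B ≤ min C D) (x y : R) :
    ∑ m ∈ Finset.Icc (max A B) (min C D),
      x ^ (C - m) * cornerFactor x A m * (y ^ (m - B) * cornerFactor y m D) =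
    edgeFactor A B y x * edgeFactor C D x y * rowSum (B ≤ A) (D ≤ C) (min C D - max A B) x y := by
  rw [rowSum, Finset.mul_sum]
  symm
  refine Finset.sum_nbij' (fun k => k + max A B) (fun m => m - max A B) ?_ ?_ ?_ ?_ ?_
  · intro k hk; rw [Finset.mem_range] at hk; rw [Finset.mem_Icc]; omega
  · intro k hk; rw [Finset.mem_range]; rw [Finset.mem_Icc] at hk; omega
  · intro k hk; omega
  · intro k hk; rw [Finset.mem_Icc] at hk; omega
  · intro k hk
    rw [Finset.mem_range] at hk
    have e1 : x ^ (C - (k + max A B)) = x ^ (C - D) * x ^ (min C D - max A B - k) := by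
      rw [← pow_add]; congr 1; omega
    have e2 : y ^ (k + max A B - B) = y ^ (A - B) * y ^ k := by
      rw [← pow_add]; congr 1; omega
    have e3 : cornerFactor x A (k + max A B) =
        cornerFactor x A B * (if B ≤ A ∧ 0 < k then 1 - x else 1) := by
      unfold cornerFactor
      by_cases hBA : B ≤ A
      · rw [if_neg (show ¬ A < B by omega), one_mul]
        exact if_congr (by omega) rfl rfl
      · rw [if_pos (show A < B by omega), if_neg (show ¬ (B ≤ A ∧ 0 < k) by omega), mul_one,
          if_pos (by omega)]
    have e4 : cornerFactor y (k + max A B) D =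
        cornerFactor y C D * (if D ≤ C ∧ k < min C D - max A B then 1 - y else 1) := by
      unfold cornerFactor
      by_cases hDC : D ≤ C
      · rw [if_neg (show ¬ C < D by omega), one_mul]
        exact if_congr (by omega) rfl rfl
      · rw [if_pos (show C < D by omega),
          if_neg (show ¬ (D ≤ C ∧ k < min C D - max A B) by omega), mul_one, if_pos (by omega)]
    rw [e1, e2, e3, e4, edgeFactor, edgeFactor]
    ring

/-- The variant of `sum_row_eq` for the first row, which is not bounded by the inner diagram. -/
theorem sum_first_row_eq (A B C : ℕ) (h : max A B ≤ C) (x y : R) :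
    ∑ m ∈ Finset.Icc (max A B) C, x ^ (C - m) * cornerFactor x A m * y ^ (m - B) =
    edgeFactor A B y x * rowSum (B ≤ A) False (C - max A B) x y := by
  rw [rowSum, Finset.mul_sum]
  symm
  refine Finset.sum_nbij' (fun k => k + max A B) (fun m => m - max A B) ?_ ?_ ?_ ?_ ?_
  · intro k hk; rw [Finset.mem_range] at hk; rw [Finset.mem_Icc]; omega
  · intro k hk; rw [Finset.mem_range]; rw [Finset.mem_Icc] at hk; omega
  · intro k hk; omega
  · intro k hk; rw [Finset.mem_Icc] at hk; omega
  · intro k hk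
    rw [Finset.mem_range] at hk
    have e1 : x ^ (C - (k + max A B)) = x ^ (C - max A B - k) := by
      congr 1; omega
    have e2 : y ^ (k + max A B - B) = y ^ (A - B) * y ^ k := by
      rw [← pow_add]; congr 1; omega
    have e3 : cornerFactor x A (k + max A B) =
        cornerFactor x A B * (if B ≤ A ∧ 0 < k then 1 - x else 1) := by
      unfold cornerFactor
      by_cases hBA : B ≤ A
      · rw [if_neg (show ¬ A < B by omega), one_mul]
        exact if_congr (by omega) rfl rfl
      · rw [if_pos (show A < B by omega), if_neg (show ¬ (B ≤ A ∧ 0 < k) by omega), mul_one,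
          if_pos (by omega)]
    rw [e1, e2, e3, edgeFactor]
    simp only [false_and, if_false]
    ring

/-- The sum over one row of the intermediate diagram in the product of two transfer matrices. -/
def rowTransfer (lam ν : ℕ → ℕ) (x y : R) : ℕ → R
  | 0 => ∑ m ∈ Finset.Icc (max (lam 1) (ν 0)) (lam 0),
      x ^ (lam 0 - m) * cornerFactor x (lam 1) m * y ^ (m - ν 0)
  | i + 1 => ∑ m ∈ Finset.Icc (max (lam (i + 2)) (ν (i + 1))) (min (lam (i + 1)) (ν i)),
      x ^ (lam (i + 1) - m) * cornerFactor x (lam (i + 2)) m *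
        (y ^ (m - ν (i + 1)) * cornerFactor y m (ν i))

/-- The product over all rows of the two-letter sums is symmetric: the factors of a row that are not
symmetric in `x` and `y` pair up with factors of the neighbouring rows. -/
theorem prod_rowTransfer_comm (lam ν : ℕ → ℕ) (N : ℕ) (hl : lam (N + 1) = 0) (hν : ν N = 0)
    (x y : R) :
    ∏ i ∈ Finset.range (N + 1), rowTransfer lam ν x y i =
      ∏ i ∈ Finset.range (N + 1), rowTransfer lam ν y x i := by
  by_cases h0 : max (lam 1) (ν 0) ≤ lam 0
  swap
  · have : ∀ x y : R, rowTransfer lam ν x y 0 = 0 := fun x y => by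
      rw [rowTransfer, Finset.Icc_eq_empty h0, Finset.sum_empty]
    rw [Finset.prod_eq_zero (i := 0) (by simp) (this x y),
      Finset.prod_eq_zero (i := 0) (by simp) (this y x)]
  by_cases hs : ∀ i < N, max (lam (i + 2)) (ν (i + 1)) ≤ min (lam (i + 1)) (ν i)
  swap
  · push Not at hs
    obtain ⟨i, hi, h⟩ := hs
    have : ∀ x y : R, rowTransfer lam ν x y (i + 1) = 0 := fun x y => by
      rw [rowTransfer, Finset.Icc_eq_empty (not_le.2 h), Finset.sum_empty]
    rw [Finset.prod_eq_zero (i := i + 1) (by simpa using hi) (this x y),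
      Finset.prod_eq_zero (i := i + 1) (by simpa using hi) (this y x)]
  have key : ∀ x y : R, ∏ i ∈ Finset.range (N + 1), rowTransfer lam ν x y i =
      (∏ i ∈ Finset.range N, edgeFactor (lam (i + 1)) (ν i) y x *
        edgeFactor (lam (i + 1)) (ν i) x y) *
      ((∏ i ∈ Finset.range N, rowSum (ν (i + 1) ≤ lam (i + 2)) (ν i ≤ lam (i + 1))
        (min (lam (i + 1)) (ν i) - max (lam (i + 2)) (ν (i + 1))) x y) *
      rowSum (ν 0 ≤ lam 1) False (lam 0 - max (lam 1) (ν 0)) x y) := by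
    intro x y
    have e1 : edgeFactor (lam (N + 1)) (ν N) y x = 1 := by
      simp [edgeFactor, cornerFactor, hl, hν]
    rw [Finset.prod_range_succ', rowTransfer, sum_first_row_eq _ _ _ h0]
    have : ∏ i ∈ Finset.range N, rowTransfer lam ν x y (i + 1) =
        ∏ i ∈ Finset.range N, (edgeFactor (lam (i + 2)) (ν (i + 1)) y x *
          edgeFactor (lam (i + 1)) (ν i) x y *
          rowSum (ν (i + 1) ≤ lam (i + 2)) (ν i ≤ lam (i + 1))
            (min (lam (i + 1)) (ν i) - max (lam (i + 2)) (ν (i + 1))) x y) :=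
      Finset.prod_congr rfl fun i hi => by
        rw [rowTransfer, sum_row_eq _ _ _ _ (hs i (Finset.mem_range.1 hi))]
    rw [this]
    simp only [Finset.prod_mul_distrib]
    have h2 := Finset.prod_range_succ' (fun i => edgeFactor (lam (i + 1)) (ν i) y x) N
    rw [Finset.prod_range_succ, e1, mul_one] at h2
    rw [h2]
    ring
  rw [key x y, key y x]
  congr 1
  · exact Finset.prod_congr rfl fun i _ => mul_comm _ _
  · congr 1
    · exact Finset.prod_congr rfl fun i _ => rowSum_comm _ _ _ _ _
    · exact rowSum_comm _ _ _ _ _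

end Transfer

/-! ### Splitting off the largest letter of a set-valued tableau -/

theorem isLowerSet_of_steps {S : Set (ℕ × ℕ)} (h1 : ∀ i j, (i + 1, j) ∈ S → (i, j) ∈ S)
    (h2 : ∀ i j, (i, j + 1) ∈ S → (i, j) ∈ S) : IsLowerSet S := by
  have hm : ∀ m c d, (c + m, d) ∈ S → (c, d) ∈ S := by
    intro m c d
    induction m with
    | zero => exact id
    | succ m ih => exact fun h => ih (h1 _ _ h)
  have hn : ∀ n c d, (c, d + n) ∈ S → (c, d) ∈ S := by
    intro n c d
    induction n with
    | zero => exact id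
    | succ n ih => exact fun h => ih (h2 _ _ h)
  rintro ⟨a, b⟩ ⟨c, d⟩ ⟨hc, hd⟩ h
  obtain ⟨m, rfl⟩ := Nat.exists_eq_add_of_le hc
  obtain ⟨n, rfl⟩ := Nat.exists_eq_add_of_le hd
  exact hn n c d (hm m c _ h)

/-- The extension by empty sets of a set-valued tableau of shape `μ` to all positions. -/
def IsFilling {α : Type*} [LinearOrder α] (μ : YoungDiagram) (F : ℕ × ℕ → Finset α) : Prop :=
  (∀ c, (F c).Nonempty ↔ c ∈ μ) ∧
  (∀ i j, ∀ a ∈ F (i, j), ∀ b ∈ F (i, j + 1), a ≤ b) ∧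
  (∀ i j, ∀ a ∈ F (i, j), ∀ b ∈ F (i + 1, j), a < b)

theorem mem_box {μ : YoungDiagram} {α : Type*} {T : μ.cells → Finset α} {i j : ℕ} {a : α} :
    a ∈ box T i j ↔ ∃ h : (i, j) ∈ μ.cells, a ∈ T ⟨(i, j), h⟩ := by
  unfold box
  split_ifs with h <;> simp [h]

theorem box_val {μ : YoungDiagram} {α : Type*} (T : μ.cells → Finset α) (c : μ.cells) :
    box T c.1.1 c.1.2 = T c := dif_pos c.2

theorem isFilling_box {μ : YoungDiagram} {α : Type*} [LinearOrder α] {T : μ.cells → Finset α} :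
    IsFilling μ (fun c => box T c.1 c.2) ↔ IsSetValuedTableau μ T := by
  constructor
  · rintro ⟨h1, h2, h3⟩
    refine ⟨fun c => ?_, fun c d hd a ha b hb => ?_, fun c d hd a ha b hb => ?_⟩
    · rw [← box_val T c]; exact (h1 c.1).2 c.2
    · rw [← box_val T] at ha hb
      rw [hd] at hb
      exact h2 _ _ a ha b hb
    · rw [← box_val T] at ha hb
      rw [hd] at hb
      exact h3 _ _ a ha b hb
  · rintro ⟨h1, h2, h3⟩
    refine ⟨fun c => ⟨?_, fun hc => ?_⟩, fun i j a ha b hb => ?_, fun i j a ha b hb => ?_⟩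
    · rintro ⟨a, ha⟩
      exact (mem_box.1 ha).1
    · obtain ⟨a, ha⟩ := h1 ⟨c, hc⟩
      exact ⟨a, mem_box.2 ⟨hc, ha⟩⟩
    · obtain ⟨h, ha⟩ := mem_box.1 ha
      obtain ⟨h', hb⟩ := mem_box.1 hb
      exact h2 ⟨_, h⟩ ⟨_, h'⟩ rfl a ha b hb
    · obtain ⟨h, ha⟩ := mem_box.1 ha
      obtain ⟨h', hb⟩ := mem_box.1 hb
      exact h3 ⟨_, h⟩ ⟨_, h'⟩ rfl a ha b hb

theorem box_injective {μ : YoungDiagram} {α : Type*} :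
    Function.Injective (fun (T : μ.cells → Finset α) (c : ℕ × ℕ) => box T c.1 c.2) := by
  intro T T' h
  funext c
  rw [← box_val T c, ← box_val T' c]
  exact congrFun h c.1

open Classical in
/-- The finite set of set-valued tableaux of shape `μ` with letters in `Fin p`, extended by
empty sets. -/
noncomputable def fillings (μ : YoungDiagram) (p : ℕ) : Finset (ℕ × ℕ → Finset (Fin p)) :=
  (Finset.univ.filter fun T : μ.cells → Finset (Fin p) => IsSetValuedTableau μ T).image
    fun T c => box T c.1 c.2

theorem mem_fillings {μ : YoungDiagram} {p : ℕ} {F : ℕ × ℕ → Finset (Fin p)} :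
    F ∈ fillings μ p ↔ IsFilling μ F := by
  simp only [fillings, Finset.mem_image, Finset.mem_filter, Finset.mem_univ, true_and]
  constructor
  · rintro ⟨T, hT, rfl⟩
    exact isFilling_box.2 hT
  · intro h
    have : (fun c : ℕ × ℕ => box (μ := μ) (fun c => F c.1) c.1 c.2) = F := by
      funext c
      by_cases hc : c ∈ μ.cells
      · exact dif_pos hc
      · rw [box, dif_neg hc]
        by_contra hne
        exact hc ((h.1 c).1 (Finset.nonempty_iff_ne_empty.2 (Ne.symm hne)))
    exact ⟨_, isFilling_box.1 (this.symm ▸ h), this⟩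

section Branching

variable {R : Type*} [CommRing R]

/-- The signed contribution `(-1)^{|S| - 1} a^S` of a box with contents `S`, for nonempty `S`. -/
def boxWeight {α : Type*} (a : α → R) (S : Finset α) : R := -∏ k ∈ S, -a k

theorem stableGroth_eq_sum_fillings (μ : YoungDiagram) {p : ℕ} (a : Fin p → R) :
    stableGroth μ a = ∑ F ∈ fillings μ p, ∏ c ∈ μ.cells, boxWeight a (F c) := by
  classical
  rw [fillings, Finset.sum_image (fun _ _ _ _ h => box_injective h), stableGroth]
  refine Finset.sum_congr (by congr) fun T hT => ?_
  have hT' : IsSetValuedTableau μ T := by simpa using hT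
  rw [← Finset.prod_coe_sort μ.cells]
  simp only [box_val, boxWeight]
  have h1 : ∀ c : μ.cells, -∏ k ∈ T c, -a k = (-1) ^ ((T c).card - 1) * ∏ k ∈ T c, a k := by
    intro c
    have hc := (hT'.1 c).card_pos
    rw [Finset.prod_neg, ← neg_one_mul, ← mul_assoc, ← pow_succ']
    congr 1
    obtain ⟨m, hm⟩ := Nat.exists_eq_add_of_lt hc
    rw [hm, show 0 + m + 1 + 1 = m + 2 by ring, show 0 + m + 1 - 1 = m by omega, pow_add]
    simp
  rw [Finset.prod_congr rfl fun c _ => h1 c, Finset.prod_mul_distrib, Finset.prod_pow_eq_pow_sum,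
    Finset.sum_tsub_distrib _ fun c _ => (hT'.1 c).card_pos]
  simp [degree, YoungDiagram.card]

/-- `lam / μ` is a horizontal strip. -/
def IsStrip (lam μ : YoungDiagram) : Prop :=
  μ ≤ lam ∧ ∀ i j, (i + 1, j) ∈ lam → (i, j) ∈ μ

open Classical in
/-- The boxes that may hold the largest letter in addition to smaller ones: those of
`μ` at the end of their row that have no box of `lam` below them. -/
def freeCorners (lam μ : YoungDiagram) : Finset (ℕ × ℕ) :=
  μ.cells.filter fun c => (c.1, c.2 + 1) ∉ μ ∧ (c.1 + 1, c.2) ∉ lam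

open Classical in
/-- Extend a filling of `μ` to a filling of `lam` by putting a new largest letter into the boxes
of `C` and of `lam / μ`. -/
def addLetter (lam μ : YoungDiagram) {p : ℕ} (F : ℕ × ℕ → Finset (Fin p)) (C : Finset (ℕ × ℕ)) :
    ℕ × ℕ → Finset (Fin (p + 1)) := fun c =>
  (F c).map Fin.castSuccEmb ∪ if c ∈ C ∨ (c ∈ lam ∧ c ∉ μ) then {Fin.last p} else ∅

variable {lam μ : YoungDiagram} {p : ℕ} {F : ℕ × ℕ → Finset (Fin p)} {C : Finset (ℕ × ℕ)}

theorem castSucc_mem_addLetter {c : ℕ × ℕ} {k : Fin p} :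
    k.castSucc ∈ addLetter lam μ F C c ↔ k ∈ F c := by
  unfold addLetter
  split_ifs <;> simp [Fin.castSucc_ne_last]

theorem last_mem_addLetter {c : ℕ × ℕ} :
    Fin.last p ∈ addLetter lam μ F C c ↔ c ∈ C ∨ (c ∈ lam ∧ c ∉ μ) := by
  unfold addLetter
  split_ifs with h <;> simp [h, Fin.castSucc_ne_last]

theorem isFilling_addLetter (hs : IsStrip lam μ) (hF : IsFilling μ F)
    (hC : C ⊆ freeCorners lam μ) : IsFilling lam (addLetter lam μ F C) := by
  have hFmem : ∀ {c k}, k ∈ F c → c ∈ μ := fun h => (hF.1 _).1 ⟨_, h⟩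
  have hCmem : ∀ {i j}, (i, j) ∈ C → (i, j) ∈ μ ∧ (i, j + 1) ∉ μ ∧ (i + 1, j) ∉ lam := by
    intro i j h
    have := hC h
    simpa [freeCorners] using this
  have hmem : ∀ {c k}, k ∈ addLetter lam μ F C c → c ∈ lam := by
    intro c k hk
    induction k using Fin.lastCases with
    | last =>
      rcases last_mem_addLetter.1 hk with h | h
      · exact hs.1 (hCmem h).1
      · exact h.1
    | cast k => exact hs.1 (hFmem (castSucc_mem_addLetter.1 hk))
  refine ⟨fun c => ⟨fun ⟨k, hk⟩ => hmem hk, fun hc => ?_⟩, ?_, ?_⟩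
  · by_cases h : c ∈ μ
    · obtain ⟨k, hk⟩ := (hF.1 c).2 h
      exact ⟨k.castSucc, castSucc_mem_addLetter.2 hk⟩
    · exact ⟨Fin.last p, last_mem_addLetter.2 (Or.inr ⟨hc, h⟩)⟩
  · intro i j a ha b hb
    induction b using Fin.lastCases with
    | last => exact Fin.le_last a
    | cast b =>
      rw [castSucc_mem_addLetter] at hb
      induction a using Fin.lastCases with
      | last =>
        rcases last_mem_addLetter.1 ha with h | h
        · exact absurd (hFmem hb) (hCmem h).2.1
        · exact absurd (μ.up_left_mem le_rfl (Nat.le_succ j) (hFmem hb)) h.2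
      | cast a =>
        rw [castSucc_mem_addLetter] at ha
        exact Fin.castSucc_le_castSucc_iff.2 (hF.2.1 i j a ha b hb)
  · intro i j a ha b hb
    induction a using Fin.lastCases with
    | last =>
      rcases last_mem_addLetter.1 ha with h | h
      · exact absurd (hmem hb) (hCmem h).2.2
      · exact absurd (hs.2 i j (hmem hb)) h.2
    | cast a =>
      induction b using Fin.lastCases with
      | last => exact Fin.castSucc_lt_last a
      | cast b =>
        rw [castSucc_mem_addLetter] at ha hb
        exact Fin.castSucc_lt_castSucc_iff.2 (hF.2.2 i j a ha b hb)

/-- Every filling of `lam` arises by adding the largest letter to a filling of a smaller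
diagram. -/
theorem exists_eq_addLetter {G : ℕ × ℕ → Finset (Fin (p + 1))} (hG : IsFilling lam G) :
    ∃ (μ : YoungDiagram) (F : ℕ × ℕ → Finset (Fin p)) (C : Finset (ℕ × ℕ)),
      IsStrip lam μ ∧ IsFilling μ F ∧ C ⊆ freeCorners lam μ ∧ addLetter lam μ F C = G := by
  classical
  have hmem : ∀ {c k}, k ∈ G c → c ∈ lam := fun h => (hG.1 _).1 ⟨_, h⟩
  let F : ℕ × ℕ → Finset (Fin p) := fun c => Finset.univ.filter fun k => k.castSucc ∈ G c
  have hF : ∀ c k, k ∈ F c ↔ k.castSucc ∈ G c := fun c k => by simp [F]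
  let μ : YoungDiagram :=
    { cells := lam.cells.filter fun c => (F c).Nonempty
      isLowerSet := by
        apply isLowerSet_of_steps
        · intro i j h
          simp only [Finset.coe_filter, Set.mem_ofPred_eq, YoungDiagram.mem_cells] at h ⊢
          obtain ⟨h, b, hb⟩ := h
          have hl := lam.up_left_mem (Nat.le_succ i) le_rfl h
          obtain ⟨a, ha⟩ := (hG.1 _).2 hl
          have hab := hG.2.2 i j a ha _ ((hF _ _).1 hb)
          obtain ⟨a', rfl⟩ := Fin.exists_castSucc_eq.2 (ne_of_lt (hab.trans_le (Fin.le_last _)))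
          exact ⟨hl, a', (hF _ _).2 ha⟩
        · intro i j h
          simp only [Finset.coe_filter, Set.mem_ofPred_eq, YoungDiagram.mem_cells] at h ⊢
          obtain ⟨h, b, hb⟩ := h
          have hl := lam.up_left_mem le_rfl (Nat.le_succ j) h
          obtain ⟨a, ha⟩ := (hG.1 _).2 hl
          have hab := hG.2.1 i j a ha _ ((hF _ _).1 hb)
          obtain ⟨a', rfl⟩ := Fin.exists_castSucc_eq.2
            (ne_of_lt (hab.trans_lt (Fin.castSucc_lt_last b)))
          exact ⟨hl, a', (hF _ _).2 ha⟩ }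
  have hμ : ∀ c, c ∈ μ ↔ (F c).Nonempty := by
    intro c
    rw [← YoungDiagram.mem_cells]
    simp only [μ, Finset.mem_filter, YoungDiagram.mem_cells, and_iff_right_iff_imp]
    rintro ⟨k, hk⟩
    exact hmem ((hF _ _).1 hk)
  have hμl : μ ≤ lam := fun c hc => by
    obtain ⟨k, hk⟩ := (hμ c).1 hc
    exact hmem ((hF _ _).1 hk)
  refine ⟨μ, F, μ.cells.filter fun c => Fin.last p ∈ G c, ⟨hμl, ?_⟩,
    ⟨fun c => (hμ c).symm, ?_, ?_⟩, ?_, ?_⟩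
  · intro i j h
    obtain ⟨b, hb⟩ := (hG.1 _).2 h
    obtain ⟨a, ha⟩ := (hG.1 _).2 (lam.up_left_mem (Nat.le_succ i) le_rfl h)
    have hab := hG.2.2 i j a ha _ hb
    obtain ⟨a', rfl⟩ := Fin.exists_castSucc_eq.2 (ne_of_lt (hab.trans_le (Fin.le_last _)))
    exact (hμ _).2 ⟨a', (hF _ _).2 ha⟩
  · intro i j a ha b hb
    exact Fin.castSucc_le_castSucc_iff.1
      (hG.2.1 i j _ ((hF _ _).1 ha) _ ((hF _ _).1 hb))
  · intro i j a ha b hb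
    exact Fin.castSucc_lt_castSucc_iff.1
      (hG.2.2 i j _ ((hF _ _).1 ha) _ ((hF _ _).1 hb))
  · rintro ⟨i, j⟩ hc
    simp only [Finset.mem_filter, YoungDiagram.mem_cells, freeCorners] at hc ⊢
    refine ⟨hc.1, fun h => ?_, fun h => ?_⟩
    · obtain ⟨k, hk⟩ := (hμ _).1 h
      exact absurd (hG.2.1 i j _ hc.2 _ ((hF _ _).1 hk)) (not_le.2 (Fin.castSucc_lt_last k))
    · obtain ⟨k, hk⟩ := (hG.1 _).2 h
      exact absurd (hG.2.2 i j _ hc.2 _ hk) (not_lt.2 (Fin.le_last k))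
  · funext c
    ext k
    induction k using Fin.lastCases with
    | cast k => rw [castSucc_mem_addLetter, hF]
    | last =>
      rw [last_mem_addLetter, Finset.mem_filter, YoungDiagram.mem_cells]
      constructor
      · rintro (h | ⟨h1, h2⟩)
        · exact h.2
        · obtain ⟨k, hk⟩ := (hG.1 _).2 h1
          induction k using Fin.lastCases with
          | last => exact hk
          | cast k => exact absurd ((hμ _).2 ⟨k, (hF _ _).2 hk⟩) h2
      · intro h
        by_cases hc : c ∈ μ
        · exact Or.inl ⟨hc, h⟩
        · exact Or.inr ⟨hmem h, hc⟩

theorem addLetter_inj {μ' : YoungDiagram} {F' : ℕ × ℕ → Finset (Fin p)} {C' : Finset (ℕ × ℕ)}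
    (hF : IsFilling μ F) (hC : C ⊆ freeCorners lam μ)
    (hF' : IsFilling μ' F') (hC' : C' ⊆ freeCorners lam μ')
    (h : addLetter lam μ F C = addLetter lam μ' F' C') : μ = μ' ∧ F = F' ∧ C = C' := by
  have h1 : F = F' := by
    funext c
    ext k
    rw [← castSucc_mem_addLetter (lam := lam) (μ := μ) (C := C), h, castSucc_mem_addLetter]
  subst h1
  have h2 : μ = μ' := by
    ext c
    rw [YoungDiagram.mem_cells, YoungDiagram.mem_cells, ← hF.1, ← hF'.1]
  subst h2
  refine ⟨rfl, rfl, ?_⟩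
  have aux : ∀ {D : Finset (ℕ × ℕ)}, D ⊆ freeCorners lam μ → ∀ c, c ∈ D ↔
      (Fin.last p ∈ addLetter lam μ F D c ∧ c ∈ μ) := by
    intro D hD c
    rw [last_mem_addLetter]
    have : c ∈ D → c ∈ μ := fun hc => by
      have := hD hc
      simp only [freeCorners, Finset.mem_filter, YoungDiagram.mem_cells] at this
      exact this.1
    tauto
  ext c
  rw [aux hC, aux hC', h]

theorem prod_boxWeight_addLetter (hs : IsStrip lam μ) (hF : IsFilling μ F)
    (hC : C ⊆ freeCorners lam μ) (a : Fin (p + 1) → R) :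
    ∏ c ∈ lam.cells, boxWeight a (addLetter lam μ F C c) =
      (∏ c ∈ μ.cells, boxWeight (fun k => a k.castSucc) (F c)) *
        (∏ _c ∈ C, -a (Fin.last p)) * a (Fin.last p) ^ (lam.card - μ.card) := by
  classical
  have hsub : μ.cells ⊆ lam.cells := YoungDiagram.cells_subset_iff.2 hs.1
  have hCsub : C ⊆ μ.cells := hC.trans (Finset.filter_subset _ _)
  rw [← Finset.prod_sdiff hsub, mul_comm]
  congr 1
  · rw [Finset.prod_subset_one_on_sdiff (g := fun c => if c ∈ C then -a (Fin.last p) else 1)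
      hCsub (fun c hc => if_neg (Finset.mem_sdiff.1 hc).2) (fun c hc => (if_pos hc).symm),
      ← Finset.prod_mul_distrib]
    refine Finset.prod_congr rfl fun c hc => ?_
    have hc' : ¬ (c ∈ lam ∧ c ∉ μ) := fun h => h.2 hc
    simp only [boxWeight, addLetter, hc', or_false]
    split_ifs with h
    · rw [Finset.prod_union (by simp [Fin.castSucc_ne_last]), Finset.prod_map]
      simp
    · simp
  · rw [YoungDiagram.card, YoungDiagram.card, ← Finset.card_sdiff_of_subset hsub,
      ← Finset.prod_const]
    refine Finset.prod_congr rfl fun c hc => ?_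
    rw [Finset.mem_sdiff] at hc
    have hFc : F c = ∅ := by
      rw [← Finset.not_nonempty_iff_eq_empty, hF.1]
      exact hc.2
    have hc' : c ∈ C ∨ c ∈ lam ∧ c ∉ μ := Or.inr hc
    simp [boxWeight, addLetter, hFc, hc']

open Classical in
/-- The diagrams `μ` such that `lam / μ` is a horizontal strip. -/
noncomputable def strips (lam : YoungDiagram) : Finset YoungDiagram :=
  (Set.toFinite (Set.Iic lam)).toFinset.filter (IsStrip lam)

theorem mem_strips : μ ∈ strips lam ↔ IsStrip lam μ := by
  simp only [strips, Finset.mem_filter, Set.Finite.mem_toFinset, Set.mem_Iic,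
    and_iff_right_iff_imp]
  exact fun h => h.1

/-- Splitting off the largest letter of the set-valued tableaux: it fills a horizontal strip
`lam / μ` and may be added to any of the free corners of `μ`. -/
theorem stableGroth_succ_eq_sum_card (lam : YoungDiagram) {p : ℕ} (a : Fin (p + 1) → R) :
    stableGroth lam a = ∑ μ ∈ strips lam, stableGroth μ (fun k => a k.castSucc) *
      (1 - a (Fin.last p)) ^ (freeCorners lam μ).card * a (Fin.last p) ^ (lam.card - μ.card) := by
  have h1 : ∀ μ ∈ strips lam, stableGroth μ (fun k => a k.castSucc) *
      (1 - a (Fin.last p)) ^ (freeCorners lam μ).card * a (Fin.last p) ^ (lam.card - μ.card) =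
      ∑ FC ∈ fillings μ p ×ˢ (freeCorners lam μ).powerset,
        ∏ c ∈ lam.cells, boxWeight a (addLetter lam μ FC.1 FC.2 c) := by
    intro μ hμ
    rw [Finset.sum_product, stableGroth_eq_sum_fillings, Finset.sum_mul, Finset.sum_mul]
    refine Finset.sum_congr rfl fun F hF => ?_
    rw [Finset.sum_congr rfl fun C hC => prod_boxWeight_addLetter (mem_strips.1 hμ)
      (mem_fillings.1 hF) (Finset.mem_powerset.1 hC) a, ← Finset.sum_mul, ← Finset.mul_sum,
      ← Finset.prod_one_add, Finset.prod_const, ← sub_eq_add_neg]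
  rw [Finset.sum_congr rfl h1, stableGroth_eq_sum_fillings, Finset.sum_sigma']
  symm
  refine Finset.sum_bij (fun x _ => addLetter lam x.1 x.2.1 x.2.2) ?_ ?_ ?_ ?_
  · rintro ⟨μ, F, C⟩ h
    simp only [Finset.mem_sigma, Finset.mem_product, Finset.mem_powerset, mem_fillings,
      mem_strips] at h ⊢
    exact isFilling_addLetter h.1 h.2.1 h.2.2
  · rintro ⟨μ, F, C⟩ h ⟨μ', F', C'⟩ h' heq
    simp only [Finset.mem_sigma, Finset.mem_product, Finset.mem_powerset, mem_fillings,
      mem_strips] at h h'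
    obtain ⟨rfl, rfl, rfl⟩ := addLetter_inj h.2.1 h.2.2 h'.2.1 h'.2.2 heq
    rfl
  · intro G hG
    obtain ⟨μ, F, C, h1, h2, h3, rfl⟩ := exists_eq_addLetter (mem_fillings.1 hG)
    exact ⟨⟨μ, F, C⟩, by simp [mem_fillings, mem_strips, h1, h2, h3], rfl⟩
  · intros; rfl

end Branching

/-! ### Symmetry of stable Grothendieck polynomials -/

section Symmetry

variable {R : Type*} [CommRing R]

theorem isStrip_iff {lam μ : YoungDiagram} :
    IsStrip lam μ ↔ ∀ i, μ.rowLen i ≤ lam.rowLen i ∧ lam.rowLen (i + 1) ≤ μ.rowLen i := by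
  rw [IsStrip, le_iff_rowLen_le, forall_and]
  refine and_congr_right fun _ => forall_congr' fun i => ?_
  simp only [YoungDiagram.mem_iff_lt_rowLen]
  exact ⟨fun h => le_of_forall_lt h, fun h j hj => hj.trans_le h⟩

/-- The weight with which a letter of value `x` fills a horizontal strip `lam / μ`, as a product
over the rows. -/
def stripWeight (N : ℕ) (lam μ : YoungDiagram) (x : R) : R :=
  ∏ i ∈ Finset.range N,
    x ^ (lam.rowLen i - μ.rowLen i) * cornerFactor x (lam.rowLen (i + 1)) (μ.rowLen i)

theorem stripWeight_eq {N : ℕ} {lam μ : YoungDiagram} (hs : IsStrip lam μ)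
    (hN : lam.colLen 0 ≤ N) (x : R) :
    stripWeight N lam μ x = (1 - x) ^ (freeCorners lam μ).card * x ^ (lam.card - μ.card) := by
  classical
  have hμN := (colLen_zero_mono hs.1).trans hN
  rw [stripWeight, Finset.prod_mul_distrib, mul_comm]
  congr 1
  · simp only [cornerFactor]
    rw [← Finset.prod_filter, Finset.prod_const]
    congr 1
    refine Finset.card_nbij' (fun i => (i, μ.rowLen i - 1)) (fun c => c.1) ?_ ?_ ?_ ?_
    · intro i hi
      simp only [Finset.coe_filter, Finset.mem_range, Set.mem_ofPred_eq, freeCorners,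
        YoungDiagram.mem_cells, YoungDiagram.mem_iff_lt_rowLen] at hi ⊢
      omega
    · rintro ⟨i, j⟩ hc
      simp only [Finset.coe_filter, Finset.mem_range, Set.mem_ofPred_eq, freeCorners,
        YoungDiagram.mem_cells, YoungDiagram.mem_iff_lt_rowLen] at hc ⊢
      refine ⟨?_, by omega⟩
      by_contra! h
      rw [rowLen_eq_zero_iff.2 (hμN.trans h)] at hc
      omega
    · intro i _; rfl
    · rintro ⟨i, j⟩ hc
      simp only [Finset.coe_filter, Set.mem_ofPred_eq, freeCorners,
        YoungDiagram.mem_cells, YoungDiagram.mem_iff_lt_rowLen] at hc ⊢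
      rw [Prod.mk.injEq]
      omega
  · rw [Finset.prod_pow_eq_pow_sum, card_eq_sum_rowLen lam hN, card_eq_sum_rowLen μ hμN,
      Finset.sum_tsub_distrib _ fun i _ => (isStrip_iff.1 hs i).1]

/-- The row-by-row form of `stableGroth_succ_eq_sum_card`: evaluation at one more letter applies a
transfer matrix. -/
theorem stableGroth_succ (lam : YoungDiagram) {N : ℕ} (hN : lam.colLen 0 ≤ N) {p : ℕ}
    (a : Fin (p + 1) → R) :
    stableGroth lam a = ∑ μ ∈ strips lam,
      stableGroth μ (fun k => a k.castSucc) * stripWeight N lam μ (a (Fin.last p)) := by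
  rw [stableGroth_succ_eq_sum_card]
  refine Finset.sum_congr rfl fun μ hμ => ?_
  rw [stripWeight_eq (mem_strips.1 hμ) hN, mul_assoc]

/-- The lengths allowed for row `i` of a diagram `μ` such that `lam / μ` and `μ / ν` are
horizontal strips. -/
def rowRange (lam ν : ℕ → ℕ) : ℕ → Finset ℕ
  | 0 => Finset.Icc (max (lam 1) (ν 0)) (lam 0)
  | i + 1 => Finset.Icc (max (lam (i + 2)) (ν (i + 1))) (min (lam (i + 1)) (ν i))

/-- The contribution of row `i` of the intermediate diagram, if it has length `m`. -/
def rowTerm (lam ν : ℕ → ℕ) (x y : R) : ℕ → ℕ → R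
  | 0, m => x ^ (lam 0 - m) * cornerFactor x (lam 1) m * y ^ (m - ν 0)
  | i + 1, m => x ^ (lam (i + 1) - m) * cornerFactor x (lam (i + 2)) m *
        (y ^ (m - ν (i + 1)) * cornerFactor y m (ν i))

theorem rowTransfer_eq (lam ν : ℕ → ℕ) (x y : R) (i : ℕ) :
    rowTransfer lam ν x y i = ∑ m ∈ rowRange lam ν i, rowTerm lam ν x y i m := by
  cases i <;> rfl

theorem forall_rowLen_mem_rowRange {lam ν μ : YoungDiagram} {N : ℕ} (hN : lam.colLen 0 ≤ N)
    (hν : ν.colLen 0 ≤ N) :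
    (∀ i, i < N + 1 → μ.rowLen i ∈ rowRange lam.rowLen ν.rowLen i) ∧ μ.colLen 0 ≤ N + 1 ↔
      IsStrip lam μ ∧ IsStrip μ ν := by
  rw [isStrip_iff, isStrip_iff]
  have hl : ∀ i, N ≤ i → lam.rowLen i = 0 := fun i hi => rowLen_eq_zero_iff.2 (hN.trans hi)
  have hn : ∀ i, N ≤ i → ν.rowLen i = 0 := fun i hi => rowLen_eq_zero_iff.2 (hν.trans hi)
  constructor
  · rintro ⟨h, hc⟩
    have hm : ∀ i, N + 1 ≤ i → μ.rowLen i = 0 := fun i hi => rowLen_eq_zero_iff.2 (hc.trans hi)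
    have key : ∀ i, max (lam.rowLen (i + 1)) (ν.rowLen i) ≤ μ.rowLen i ∧
        μ.rowLen i ≤ lam.rowLen i ∧ μ.rowLen (i + 1) ≤ ν.rowLen i := by
      intro i
      refine ⟨?_, ?_, ?_⟩
      · by_cases hi : i < N + 1
        · have := h i hi
          rcases i with _ | i <;> rw [rowRange, Finset.mem_Icc] at this <;> exact this.1
        · rw [hl _ (by omega), hn _ (by omega)]; simp
      · by_cases hi : i < N + 1
        · have := h i hi
          rcases i with _ | i <;> rw [rowRange, Finset.mem_Icc] at this <;> omega
        · rw [hm _ (by omega)]; simp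
      · by_cases hi : i + 1 < N + 1
        · have := h (i + 1) hi
          rw [rowRange, Finset.mem_Icc] at this; omega
        · rw [hm _ (by omega)]; simp
    exact ⟨fun i => by have := key i; omega, fun i => by have := key i; omega⟩
  · rintro ⟨h1, h2⟩
    refine ⟨fun i _ => ?_, ?_⟩
    · rcases i with _ | i <;> rw [rowRange, Finset.mem_Icc]
      · exact ⟨max_le (h1 0).2 (h2 0).1, (h1 0).1⟩
      · exact ⟨max_le (h1 (i + 1)).2 (h2 (i + 1)).1, le_min (h1 (i + 1)).1 (h2 i).2⟩
    · rw [← rowLen_eq_zero_iff]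
      have := h1 (N + 1)
      rw [hl (N + 1) (by omega)] at this
      omega

open Classical in
/-- The product of two transfer matrices factors over the rows. -/
theorem sum_stripWeight_mul_stripWeight {lam ν : YoungDiagram} {N : ℕ} (hN : lam.colLen 0 ≤ N)
    (hν : ν.colLen 0 ≤ N) (x y : R) :
    ∑ μ ∈ strips lam with ν ∈ strips μ,
        stripWeight (N + 1) lam μ x * stripWeight (N + 1) μ ν y =
      ∏ i ∈ Finset.range (N + 1), rowTransfer lam.rowLen ν.rowLen x y i := by
  have hl : ∀ i, N ≤ i → lam.rowLen i = 0 := fun i hi => rowLen_eq_zero_iff.2 (hN.trans hi)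
  have hn : ∀ i, N ≤ i → ν.rowLen i = 0 := fun i hi => rowLen_eq_zero_iff.2 (hν.trans hi)
  rw [Finset.prod_range]
  simp only [rowTransfer_eq]
  rw [Finset.prod_univ_sum]
  refine Finset.sum_bij (fun μ _ i => μ.rowLen i) ?_ ?_ ?_ ?_
  · intro μ hμ
    rw [Finset.mem_filter, mem_strips, mem_strips] at hμ
    rw [Fintype.mem_piFinset]
    exact fun i => ((forall_rowLen_mem_rowRange hN hν).2 hμ).1 i i.2
  · intro μ hμ μ' hμ' h
    rw [Finset.mem_filter, mem_strips, mem_strips] at hμ hμ'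
    refine eq_of_rowLen_eq fun i => ?_
    by_cases hi : i < N + 1
    · exact congrFun h ⟨i, hi⟩
    · rw [rowLen_eq_zero_iff.2, rowLen_eq_zero_iff.2]
      · exact ((forall_rowLen_mem_rowRange hN hν).2 hμ').2.trans (by omega)
      · exact ((forall_rowLen_mem_rowRange hN hν).2 hμ).2.trans (by omega)
  · intro m hm
    rw [Fintype.mem_piFinset] at hm
    let f : ℕ → ℕ := fun i => if h : i < N + 1 then m ⟨i, h⟩ else 0
    have hf0 : ∀ i, N + 1 ≤ i → f i = 0 := fun i hi => dif_neg (by omega)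
    have hfm : ∀ i, i < N + 1 → f i ∈ rowRange lam.rowLen ν.rowLen i := fun i hi => by
      simp only [f, dif_pos hi]
      exact hm ⟨i, hi⟩
    have hf : Antitone f := by
      refine antitone_nat_of_succ_le fun i => ?_
      by_cases hi : i + 1 < N + 1
      · have h1 := hfm i (by omega)
        have h2 := hfm (i + 1) hi
        rw [rowRange, Finset.mem_Icc] at h2
        rcases i with _ | i <;> rw [rowRange, Finset.mem_Icc] at h1 <;> omega
      · rw [hf0 _ (by omega)]; exact Nat.zero_le _
    have hrow := rowLen_diagramOfRows hf hf0
    refine ⟨diagramOfRows f hf (N + 1), ?_, ?_⟩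
    · rw [Finset.mem_filter, mem_strips, mem_strips, ← forall_rowLen_mem_rowRange hN hν]
      refine ⟨fun i hi => by rw [hrow]; exact hfm i hi, ?_⟩
      rw [← rowLen_eq_zero_iff, hrow, hf0 _ le_rfl]
    · funext i
      rw [hrow]
      exact dif_pos i.2
  · intro μ hμ
    rw [← Finset.prod_range (fun i => rowTerm lam.rowLen ν.rowLen x y i (μ.rowLen i)), stripWeight,
      stripWeight,
      Finset.prod_range_succ' (fun i => rowTerm lam.rowLen ν.rowLen x y i (μ.rowLen i))]
    simp only [rowTerm, Finset.prod_mul_distrib]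
    rw [Finset.prod_range_succ (fun i => cornerFactor y (μ.rowLen (i + 1)) (ν.rowLen i)),
      Finset.prod_range_succ' (fun i => x ^ (lam.rowLen i - μ.rowLen i)),
      Finset.prod_range_succ' (fun i => y ^ (μ.rowLen i - ν.rowLen i)),
      Finset.prod_range_succ' (fun i => cornerFactor x (lam.rowLen (i + 1)) (μ.rowLen i)),
      hn N le_rfl]
    simp only [cornerFactor, Nat.not_lt_zero, if_false]
    ring

theorem stableGroth_succ_succ (lam : YoungDiagram) {p : ℕ} (a : Fin (p + 2) → R) :
    stableGroth lam a = ∑ ν ∈ (Set.toFinite (Set.Iic lam)).toFinset,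
      stableGroth ν (fun k => a k.castSucc.castSucc) *
        ∏ i ∈ Finset.range (lam.colLen 0 + 1), rowTransfer lam.rowLen ν.rowLen
          (a (Fin.last (p + 1))) (a (Fin.last p).castSucc) i := by
  classical
  rw [stableGroth_succ lam (Nat.le_succ _)]
  have h1 : ∀ μ ∈ strips lam, stableGroth μ (fun k : Fin (p + 1) => a k.castSucc) *
      stripWeight (lam.colLen 0 + 1) lam μ (a (Fin.last (p + 1))) =
      ∑ ν ∈ (Set.toFinite (Set.Iic lam)).toFinset with ν ∈ strips μ,
        stableGroth ν (fun k => a k.castSucc.castSucc) *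
        (stripWeight (lam.colLen 0 + 1) lam μ (a (Fin.last (p + 1))) *
          stripWeight (lam.colLen 0 + 1) μ ν (a (Fin.last p).castSucc)) := by
    intro μ hμ
    have hμl := (mem_strips.1 hμ).1
    rw [stableGroth_succ μ ((colLen_zero_mono hμl).trans (Nat.le_succ _)), Finset.sum_mul]
    refine Finset.sum_congr ?_ fun ν _ => by ring
    ext ν
    simp only [Finset.mem_filter, Set.Finite.mem_toFinset, Set.mem_Iic]
    exact ⟨fun h => ⟨(mem_strips.1 h).1.trans hμl, h⟩, fun h => h.2⟩
  rw [Finset.sum_congr rfl h1, Finset.sum_comm' (t' := (Set.toFinite (Set.Iic lam)).toFinset)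
    (s' := fun ν => (strips lam).filter fun μ => ν ∈ strips μ)]
  · refine Finset.sum_congr rfl fun ν hν => ?_
    rw [← Finset.mul_sum, sum_stripWeight_mul_stripWeight le_rfl]
    exact colLen_zero_mono (by simpa using hν)
  · intro μ ν
    simp only [Finset.mem_filter]
    tauto

theorem stableGroth_swap (p : ℕ) : ∀ (lam : YoungDiagram) (i : Fin p) (a : Fin (p + 1) → R),
    stableGroth lam (a ∘ Equiv.swap i.castSucc i.succ) = stableGroth lam a := by
  induction p with
  | zero => exact fun _ i => i.elim0
  | succ p ih =>
    intro lam i a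
    induction i using Fin.lastCases with
    | last =>
      rw [stableGroth_succ_succ, stableGroth_succ_succ]
      refine Finset.sum_congr rfl fun ν hν => ?_
      rw [Set.Finite.mem_toFinset, Set.mem_Iic] at hν
      simp only [Function.comp_apply]
      congr 1
      · congr 1
        funext k
        rw [Equiv.swap_apply_of_ne_of_ne]
        · exact fun h => Fin.castSucc_ne_last k (Fin.castSucc_injective _ h)
        · rw [Fin.succ_last]
          exact Fin.castSucc_ne_last _
      · rw [← Fin.succ_last, Equiv.swap_apply_right, Equiv.swap_apply_left]
        exact prod_rowTransfer_comm _ _ _ (rowLen_eq_zero_iff.2 (Nat.le_succ _))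
          (rowLen_eq_zero_iff.2 (colLen_zero_mono hν)) _ _
    | cast i =>
      rw [stableGroth_succ lam le_rfl, stableGroth_succ lam le_rfl]
      refine Finset.sum_congr rfl fun μ _ => ?_
      congr 1
      · rw [← ih μ i (fun k => a k.castSucc)]
        congr 1
        funext k
        simp only [Function.comp_apply]
        congr 1
        rw [Fin.succ_castSucc, (Fin.castSucc_injective _).swap_apply]
      · rw [Function.comp_apply, Equiv.swap_apply_of_ne_of_ne]
        · exact (Fin.castSucc_ne_last _).symm
        · rw [Fin.succ_castSucc]
          exact (Fin.castSucc_ne_last _).symm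

/-- Stable Grothendieck polynomials are symmetric. -/
theorem stableGroth_comp_perm (lam : YoungDiagram) {p : ℕ} (a : Fin p → R)
    (σ : Equiv.Perm (Fin p)) : stableGroth lam (a ∘ σ) = stableGroth lam a := by
  rcases p with _ | p
  · rw [Subsingleton.elim σ 1]; rfl
  have hσ : σ ∈ Submonoid.closure
      (Set.range fun i : Fin p => Equiv.swap i.castSucc i.succ) := by
    rw [Equiv.Perm.mclosure_swap_castSucc_succ]; trivial
  induction hσ using Submonoid.closure_induction generalizing a with
  | mem σ h => obtain ⟨i, rfl⟩ := h; exact stableGroth_swap p lam i a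
  | one => rfl
  | mul σ τ _ _ h1 h2 =>
    rw [Equiv.Perm.coe_mul, ← Function.comp_assoc, h2, h1]

end Symmetry

/-! ### Words -/

theorem sum_map_range (f : ℕ → ℕ) (n : ℕ) :
    ((List.range n).map f).sum = ∑ i ∈ Finset.range n, f i := rfl

/-- The word made of the words `r (n - 1), …, r 0`, in this order. -/
def stack (r : ℕ → List ℕ) (n : ℕ) : List ℕ := (List.range n).reverse.flatMap r

theorem stack_succ (r : ℕ → List ℕ) (n : ℕ) : stack r (n + 1) = r n ++ stack r n := by
  simp [stack, List.range_succ]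

theorem stack_zero (r : ℕ → List ℕ) : stack r 0 = [] := rfl

theorem length_stack (r : ℕ → List ℕ) (n : ℕ) :
    (stack r n).length = ∑ i ∈ Finset.range n, (r i).length := by
  induction n with
  | zero => rfl
  | succ n ih => rw [stack_succ, List.length_append, ih, Finset.sum_range_succ, add_comm]

theorem count_stack (r : ℕ → List ℕ) (n k : ℕ) :
    (stack r n).count k = ∑ i ∈ Finset.range n, (r i).count k := by
  induction n with
  | zero => rfl
  | succ n ih => rw [stack_succ, List.count_append, ih, Finset.sum_range_succ, add_comm]

/-- The word of row `i` of a tableau. -/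
def rowWord {μ : YoungDiagram} (T : μ.cells → Finset ℕ) (i : ℕ) : List ℕ :=
  (List.range (μ.rowLen i)).flatMap fun j => (box T i j).sort (· ≤ ·)

theorem word_eq_stack {μ : YoungDiagram} (T : μ.cells → Finset ℕ) :
    word T = stack (rowWord T) (μ.colLen 0) := rfl

theorem length_word {μ : YoungDiagram} (T : μ.cells → Finset ℕ) :
    (word T).length = degree T := by
  have h : degree T = ∑ c ∈ μ.cells, (box T c.1 c.2).card := by
    rw [degree, ← Finset.sum_coe_sort μ.cells]
    exact Finset.sum_congr rfl fun c _ => by rw [box_val]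
  rw [h, sum_cells μ le_rfl, word_eq_stack, length_stack]
  refine Finset.sum_congr rfl fun i _ => ?_
  rw [rowWord, List.length_flatMap, ← sum_map_range]
  simp

theorem card_le_degree {μ : YoungDiagram} {α : Type*} [LinearOrder α] {T : μ.cells → Finset α}
    (hT : IsSetValuedTableau μ T) : μ.card ≤ degree T := by
  have := Finset.sum_le_sum (s := Finset.univ) (f := fun _ : μ.cells => 1)
    fun c _ => (hT.1 c).card_pos
  simpa [degree, YoungDiagram.card] using this

theorem count_canonicalWord (ν : YoungDiagram) (k : ℕ) :
    (canonicalWord ν).count k = ν.rowLen k := by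
  change (stack (fun i => List.replicate (ν.rowLen i) i) (ν.colLen 0)).count k = _
  rw [count_stack]
  simp only [List.count_replicate, beq_iff_eq]
  rw [Finset.sum_ite_eq' (Finset.range _) k]
  split_ifs with h
  · rfl
  · rw [rowLen_eq_zero_iff.2]
    simpa using h

theorem length_eq_card_of_hasContent {l : List ℕ} {ν : YoungDiagram} (h : HasContent l ν) :
    l.length = ν.card := by
  rw [card_eq_sum_rowLen ν le_rfl]
  have h2 : ∀ a ∈ (l : Multiset ℕ), a ∈ Finset.range (ν.colLen 0) := by
    intro a ha
    rw [Finset.mem_range]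
    by_contra! hlt
    have h3 := h a
    rw [rowLen_eq_zero_iff.2 hlt, List.count_eq_zero] at h3
    exact h3 ha
  have h4 := Multiset.sum_count_eq_card h2
  rw [Multiset.coe_card] at h4
  rw [← h4]
  exact Finset.sum_congr rfl fun k _ => by rw [Multiset.coe_count, h k]

theorem length_canonicalWord (ν : YoungDiagram) : (canonicalWord ν).length = ν.card :=
  length_eq_card_of_hasContent (count_canonicalWord ν)

theorem IsReverseLattice.of_append {l l' : List ℕ} (h : IsReverseLattice (l ++ l')) :
    IsReverseLattice l' := by
  intro l₁ l₂ k hk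
  exact h (l ++ l₁) l₂ k (by rw [hk, List.append_assoc])

theorem IsReverseLattice.count_succ_le {l : List ℕ} (h : IsReverseLattice l) (k : ℕ) :
    l.count (k + 1) ≤ l.count k := by
  induction l with
  | nil => rfl
  | cons a l ih =>
    have ih' := ih (IsReverseLattice.of_append (l := [a]) h)
    by_cases ha : a = k + 1
    · subst ha
      have := h [] l k rfl
      simp
      omega
    · rw [List.count_cons_of_ne ha]
      exact ih'.trans List.count_le_count_cons

/-- If a weakly increasing word is put in front of `l`, all its letters `k + 1` are still followed
by at least as many letters `k` already present in `l`. -/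
theorem IsReverseLattice.count_append_le {r l : List ℕ} (hr : r.Pairwise (· ≤ ·))
    (h : IsReverseLattice (r ++ l)) (k : ℕ) : (r ++ l).count (k + 1) ≤ l.count k := by
  induction r with
  | nil => exact h.count_succ_le k
  | cons a r ih =>
    have ih' := ih (List.pairwise_cons.1 hr).2 (IsReverseLattice.of_append (l := [a]) h)
    by_cases ha : a = k + 1
    · subst ha
      have h1 := h [] (r ++ l) k rfl
      have h2 : r.count k = 0 := by
        rw [List.count_eq_zero]
        intro hk
        have := (List.pairwise_cons.1 hr).1 k hk
        omega
      rw [List.count_append, List.count_append, h2, zero_add] at h1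
      rw [List.cons_append, List.count_cons_self, List.count_append]
      omega
    · rw [List.cons_append, List.count_cons_of_ne ha]
      exact ih'

theorem IsReverseLattice.append {r l : List ℕ} (h : IsReverseLattice l)
    (hk : ∀ k, (r ++ l).count (k + 1) ≤ l.count k) : IsReverseLattice (r ++ l) := by
  induction r with
  | nil => exact h
  | cons a r ih =>
    have ih' := ih fun k => le_trans (by
      rw [List.cons_append]; exact List.count_le_count_cons) (hk k)
    intro l₁ l₂ k hl
    rcases l₁ with _ | ⟨b, l₁⟩
    · simp only [List.cons_append, List.nil_append, List.cons.injEq] at hl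
      obtain ⟨rfl, rfl⟩ := hl
      have := hk k
      simp only [List.cons_append, List.count_cons_self, List.count_append] at this ⊢
      omega
    · simp only [List.cons_append, List.cons.injEq] at hl
      exact ih' l₁ l₂ k hl.2

theorem isReverseLattice_nil : IsReverseLattice [] := by
  intro l₁ l₂ k h
  simp at h

theorem isReverseLattice_canonicalWord (ν : YoungDiagram) :
    IsReverseLattice (canonicalWord ν) := by
  change IsReverseLattice (stack (fun i => List.replicate (ν.rowLen i) i) (ν.colLen 0))
  have hc : ∀ n k, (stack (fun i => List.replicate (ν.rowLen i) i) n).count k =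
      if k < n then ν.rowLen k else 0 := by
    intro n k
    rw [count_stack]
    simp only [List.count_replicate, beq_iff_eq]
    rw [Finset.sum_ite_eq' (Finset.range _) k]
    simp
  generalize ν.colLen 0 = n
  induction n with
  | zero => exact isReverseLattice_nil
  | succ n ih =>
    have hs := stack_succ (fun i => List.replicate (ν.rowLen i) i) n
    rw [hs]
    refine ih.append fun k => ?_
    rw [← hs, hc, hc]
    have := ν.rowLen_anti k (k + 1) (Nat.le_succ k)
    split_ifs <;> omega

/-! ### The coproduct coefficients that govern the lowest terms -/

theorem rowLen_rect {p q i : ℕ} (hi : i < p) : (rect p q).rowLen i = q := by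
  refine le_antisymm ?_ ?_ <;> refine le_of_forall_lt fun j hj => ?_
  · exact (mem_rect.1 (YoungDiagram.mem_iff_lt_rowLen.2 hj)).2
  · exact YoungDiagram.mem_iff_lt_rowLen.1 (mem_rect.2 ⟨hi, hj⟩)

theorem colLen_rect {p q : ℕ} (hq : 0 < q ∨ p = 0) : (rect p q).colLen 0 = p := by
  refine le_antisymm ?_ ?_ <;> refine le_of_forall_lt fun j hj => ?_
  · exact (mem_rect.1 (YoungDiagram.mem_iff_lt_colLen.2 hj)).1
  · exact YoungDiagram.mem_iff_lt_colLen.1 (mem_rect.2 ⟨hj, by omega⟩)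

theorem card_rect (p q : ℕ) : (rect p q).card = p * q := by
  simp [YoungDiagram.card, rect]

theorem mem_attach {p q i j : ℕ} {lam μ : YoungDiagram} {hl : lam ≤ rect p q}
    {hm : μ ≤ rect p q} : (i, j) ∈ attach p q lam μ hl hm ↔
      if i < p then j < q ∨ (i, j - q) ∈ μ else (i - p, j) ∈ lam := by
  rw [← YoungDiagram.mem_cells]
  simp only [attach, Finset.mem_union, Finset.mem_image, Prod.exists, YoungDiagram.mem_cells,
    Prod.mk.injEq, mem_rect]
  split_ifs with h
  · constructor
    · rintro ((h1 | ⟨a, b, hab, rfl, rfl⟩) | ⟨a, b, hab, rfl, rfl⟩)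
      · exact Or.inl h1.2
      · exact Or.inr (by simpa using hab)
      · omega
    · intro h1
      by_cases hj : j < q
      · exact Or.inl (Or.inl ⟨h, hj⟩)
      · exact Or.inl (Or.inr ⟨i, j - q, by tauto, rfl, by omega⟩)
  · constructor
    · rintro ((h1 | ⟨a, b, hab, rfl, rfl⟩) | ⟨a, b, hab, rfl, rfl⟩)
      · omega
      · exact absurd (mem_rect.1 (hm hab)).1 h
      · simpa using hab
    · intro h1
      exact Or.inr ⟨i - p, j, h1, by omega, rfl⟩

theorem rowLen_attach {p q i : ℕ} {lam μ : YoungDiagram} {hl : lam ≤ rect p q}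
    {hm : μ ≤ rect p q} : (attach p q lam μ hl hm).rowLen i =
      if i < p then q + μ.rowLen i else lam.rowLen (i - p) := by
  refine eq_of_forall_lt_iff fun j => ?_
  rw [← YoungDiagram.mem_iff_lt_rowLen, mem_attach]
  split_ifs
  · rw [YoungDiagram.mem_iff_lt_rowLen]; omega
  · rw [YoungDiagram.mem_iff_lt_rowLen]

theorem colLen_zero_le_of_le_rect {p q : ℕ} {lam : YoungDiagram} (h : lam ≤ rect p q) :
    lam.colLen 0 ≤ p := by
  refine le_of_forall_lt fun i hi => ?_
  exact (mem_rect.1 (h (YoungDiagram.mem_iff_lt_colLen.2 hi))).1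

theorem rowLen_zero_le_of_le_rect {p q : ℕ} {lam : YoungDiagram} (h : lam ≤ rect p q) :
    lam.rowLen 0 ≤ q := by
  refine le_of_forall_lt fun i hi => ?_
  exact (mem_rect.1 (h (YoungDiagram.mem_iff_lt_rowLen.2 hi))).2

theorem card_attach {p q : ℕ} {lam μ : YoungDiagram} {hl : lam ≤ rect p q}
    {hm : μ ≤ rect p q} : (attach p q lam μ hl hm).card = p * q + lam.card + μ.card := by
  have hl' := colLen_zero_le_of_le_rect hl
  have h : (attach p q lam μ hl hm).colLen 0 ≤ p + p := by
    rw [← rowLen_eq_zero_iff, rowLen_attach, if_neg (by omega), rowLen_eq_zero_iff]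
    omega
  rw [card_eq_sum_rowLen _ h, Finset.sum_range_add, card_eq_sum_rowLen lam hl',
    card_eq_sum_rowLen μ (colLen_zero_le_of_le_rect hm)]
  simp only [rowLen_attach]
  rw [Finset.sum_congr rfl fun i hi => if_pos (Finset.mem_range.1 hi), Finset.sum_add_distrib]
  simp
  ring

/-- The coefficient `d^ν_{λμ}` vanishes if `|λ| + |μ| < |ν|`. -/
theorem card_le_of_coprodCoeff_ne_zero {p q : ℕ} {ν lam μ : YoungDiagram}
    {hl : lam ≤ rect p q} {hm : μ ≤ rect p q} (h : coprodCoeff p q ν lam μ hl hm ≠ 0) :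
    ν.card ≤ lam.card + μ.card := by
  have h1 := right_ne_zero_of_mul h
  have h2 : Nat.card _ ≠ 0 := Nat.cast_ne_zero.1 h1
  obtain ⟨T, hT, -, hc⟩ := (Nat.card_ne_zero.1 h2).1
  have h3 := length_eq_card_of_hasContent hc
  rw [List.length_append, length_word, length_canonicalWord, card_attach] at h3
  have h4 := card_le_degree hT
  rw [card_rect] at h4
  omega

section Unit

variable {p q : ℕ} {ν : YoungDiagram}

/-- The multiplicity of the letter `k` in `u(ν)` and the first `i` rows of a tableau of rectangular
shape with `q` columns that contributes to `d^ν_{ν∅}`. -/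
def partialContent (q : ℕ) (ν : YoungDiagram) (i k : ℕ) : ℕ :=
  if k < i then q else ν.rowLen (k - i)

/-- The content of every row is forced. At each step the first multiplicity is at most `q`, the
multiplicity of `k + 1` is at most the previous multiplicity of `k`, and the total increases by
`q`; so these are equalities. -/
theorem count_eq_partialContent {r : ℕ → List ℕ} (hs : ∀ i < p, (r i).Pairwise (· ≤ ·))
    (hlen : ∀ i < p, (r i).length = q)
    (hL : IsReverseLattice (stack r p ++ canonicalWord ν))
    (hc : ∀ k, (stack r p ++ canonicalWord ν).count k = partialContent q ν p k) (i : ℕ)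
    (hi : i ≤ p) (k : ℕ) :
    (stack r i ++ canonicalWord ν).count k = partialContent q ν i k := by
  have hsuf : ∀ n i, i + n = p → IsReverseLattice (stack r i ++ canonicalWord ν) ∧
      ∀ k, (stack r i ++ canonicalWord ν).count k ≤ partialContent q ν p k := by
    intro n
    induction n with
    | zero => rintro i rfl; exact ⟨hL, fun k => (hc k).le⟩
    | succ n ih =>
      intro i hi
      have h := ih (i + 1) (by omega)
      rw [stack_succ, List.append_assoc] at h
      refine ⟨h.1.of_append, fun k => le_trans ?_ (h.2 k)⟩
      rw [List.count_append (l₁ := r i)]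
      omega
  induction i generalizing k with
  | zero => simp [stack_zero, count_canonicalWord, partialContent]
  | succ i ih =>
    have ih := fun k => ih (by omega) k
    obtain ⟨h1, h2⟩ := hsuf (p - (i + 1)) (i + 1) (by omega)
    rw [stack_succ, List.append_assoc] at h1 h2 ⊢
    set l := stack r i ++ canonicalWord ν with hl
    have h3 := h1.count_append_le (hs i (by omega))
    have hK : ∀ k, p + ν.colLen 0 ≤ k → partialContent q ν p k = 0 := by
      intro k hk
      rw [partialContent, if_neg (by omega), rowLen_eq_zero_iff]
      omega
    have hlK : ∀ k, p + ν.colLen 0 ≤ k → l.count k = 0 := by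
      intro k hk
      have := h2 k
      rw [hK k hk, List.count_append] at this
      omega
    have hsum : ∀ (m : List ℕ) K, (∀ k, K ≤ k → m.count k = 0) →
        ∑ k ∈ Finset.range K, m.count k = m.length := by
      intro m K hm
      have := Multiset.sum_count_eq_card (s := Finset.range K) (m := (m : Multiset ℕ)) (by
        intro a ha
        by_contra! hlt
        rw [Finset.mem_range, not_lt] at hlt
        exact List.count_eq_zero.1 (hm a hlt) ha)
      simpa using this
    set K := p + ν.colLen 0 with hKdef
    have s1 := hsum l K hlK
    have s2 := hsum (r i ++ l) (K + 1) fun k hk => by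
      have := h2 k
      rw [hK k (by omega)] at this
      omega
    rw [Finset.sum_range_succ', List.length_append, hlen i (by omega)] at s2
    have h0 : (r i ++ l).count 0 ≤ q := by
      have := h2 0
      rwa [partialContent, if_pos (by omega)] at this
    have hle := Finset.sum_le_sum (s := Finset.range K) fun k _ => h3 k
    have h0' : (r i ++ l).count 0 = q := by omega
    have heq := (Finset.sum_eq_sum_iff_of_le (s := Finset.range K) fun k _ => h3 k).1 (by omega)
    rcases k with _ | k
    · rw [h0', partialContent, if_pos (Nat.succ_pos i)]
    · by_cases hkK : k < K
      · rw [heq k (Finset.mem_range.2 hkK), ih, partialContent, partialContent,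
          Nat.add_sub_add_right]
        exact if_congr (by omega) rfl rfl
      · have e1 := h3 k
        have e2 := hlK k (by omega)
        have e3 := ih k
        rw [e2] at e3 e1
        rw [partialContent] at e3 ⊢
        rw [Nat.add_sub_add_right, if_congr (show k + 1 < i + 1 ↔ k < i by omega) rfl rfl, ← e3]
        omega

/-- Row `i` of the tableau that contributes to `d^ν_{ν∅}`. -/
def columnRow (q : ℕ) (ν : YoungDiagram) (i : ℕ) : List ℕ :=
  (List.range q).map fun j => i + ν.colLen (q - 1 - j)

theorem count_columnRow_add (hν : ν.rowLen 0 ≤ q) (i k : ℕ) :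
    (columnRow q ν i).count k + partialContent q ν i k = partialContent q ν (i + 1) k := by
  have h1 : (columnRow q ν i).count k =
      ((Finset.range q).filter fun c => i + ν.colLen c = k).card := by
    have : (columnRow q ν i).count k =
        ((Finset.range q).filter fun j => k = i + ν.colLen (q - 1 - j)).card := by
      rw [columnRow, ← Multiset.coe_count, ← Multiset.map_coe, Multiset.count_map]
      rfl
    rw [this]
    refine Finset.card_nbij' (fun j => q - 1 - j) (fun j => q - 1 - j) ?_ ?_ ?_ ?_
    · intro j hj
      simp only [Finset.coe_filter, Finset.mem_range, Set.mem_ofPred_eq] at hj ⊢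
      omega
    · intro j hj
      simp only [Finset.coe_filter, Finset.mem_range, Set.mem_ofPred_eq] at hj ⊢
      rw [show q - 1 - (q - 1 - j) = j by omega]
      omega
    · intro j hj
      simp only [Finset.coe_filter, Finset.mem_range, Set.mem_ofPred_eq] at hj ⊢
      omega
    · intro j hj
      simp only [Finset.coe_filter, Finset.mem_range, Set.mem_ofPred_eq] at hj ⊢
      omega
  have hmem : ∀ m c, c < ν.rowLen m ↔ m < ν.colLen c := fun m c => by
    rw [← YoungDiagram.mem_iff_lt_rowLen, YoungDiagram.mem_iff_lt_colLen]
  rw [h1, partialContent, partialContent]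
  rcases lt_trichotomy k i with h | h | h
  · rw [if_pos h, if_pos (by omega), Finset.filter_false_of_mem (fun c _ => by omega)]
    simp
  · subst h
    rw [if_neg (lt_irrefl _), if_pos (Nat.lt_succ_self _), Nat.sub_self]
    have : (Finset.range q).filter (fun c => k + ν.colLen c = k) =
        Finset.Ico (ν.rowLen 0) q := by
      ext c
      have := hmem 0 c
      rw [Finset.mem_filter, Finset.mem_range, Finset.mem_Ico]
      omega
    rw [this, Nat.card_Ico]
    omega
  · obtain ⟨m, rfl⟩ := Nat.exists_eq_add_of_lt h
    rw [if_neg (by omega), if_neg (by omega), show i + m + 1 - i = m + 1 by omega,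
      show i + m + 1 - (i + 1) = m by omega]
    have hm := ν.rowLen_anti m (m + 1) (Nat.le_succ m)
    have h0 := ν.rowLen_anti 0 m (Nat.zero_le m)
    have : (Finset.range q).filter (fun c => i + ν.colLen c = i + m + 1) =
        Finset.Ico (ν.rowLen (m + 1)) (ν.rowLen m) := by
      ext c
      have h2 := hmem m c
      have h3 := hmem (m + 1) c
      rw [Finset.mem_filter, Finset.mem_range, Finset.mem_Ico]
      omega
    rw [this, Nat.card_Ico]
    omega

theorem count_stack_columnRow (hν : ν.rowLen 0 ≤ q) (i k : ℕ) :
    (stack (columnRow q ν) i ++ canonicalWord ν).count k = partialContent q ν i k := by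
  induction i with
  | zero => simp [stack_zero, count_canonicalWord, partialContent]
  | succ i ih =>
    rw [stack_succ, List.append_assoc, List.count_append, ih, count_columnRow_add hν]

theorem isReverseLattice_stack_columnRow (hν : ν.rowLen 0 ≤ q) (i : ℕ) :
    IsReverseLattice (stack (columnRow q ν) i ++ canonicalWord ν) := by
  induction i with
  | zero => exact isReverseLattice_canonicalWord ν
  | succ i ih =>
    rw [stack_succ, List.append_assoc]
    refine ih.append fun k => ?_
    rw [← List.append_assoc, ← stack_succ, count_stack_columnRow hν, count_stack_columnRow hν,
      partialContent, partialContent, Nat.add_sub_add_right,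
      if_congr (show k + 1 < i + 1 ↔ k < i by omega) rfl rfl]

theorem stack_congr {r r' : ℕ → List ℕ} {n : ℕ} (h : ∀ i < n, r i = r' i) :
    stack r n = stack r' n := by
  induction n with
  | zero => rfl
  | succ n ih =>
    rw [stack_succ, stack_succ, h n (Nat.lt_succ_self n), ih fun i hi => h i (by omega)]

/-- A tableau of rectangular shape with a single letter in each box is determined by its row
words. -/
theorem rowWord_of_singleton {T : (rect p q).cells → Finset ℕ} {t : ℕ → ℕ → ℕ}
    (hT : ∀ i j, i < p → j < q → box T i j = {t i j}) {i : ℕ} (hi : i < p) :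
    rowWord T i = (List.range q).map (t i) := by
  rw [rowWord, rowLen_rect hi, List.map_eq_flatMap]
  refine List.flatMap_congr fun j hj => ?_
  rw [hT i j hi (List.mem_range.1 hj), Finset.sort_singleton]

/-- The only tableau that contributes to `d^ν_{ν∅}` has the letter `i + ν'_{q-1-j}` in the box
`(i, j)`, with `ν'` the conjugate partition. -/
theorem coprodCoeff_self_bot (hq : 0 < q ∨ p = 0) (hl : ν ≤ rect p q) (hm : ⊥ ≤ rect p q) :
    coprodCoeff p q ν ν ⊥ hl hm = 1 := by
  have hν := rowLen_zero_le_of_le_rect hl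
  have hcont : ∀ k, (attach p q ν ⊥ hl hm).rowLen k = partialContent q ν p k := by
    intro k
    rw [rowLen_attach, partialContent]
    have : (⊥ : YoungDiagram).rowLen k = 0 := by
      rw [← Nat.le_zero]
      refine le_of_forall_lt fun j hj => ?_
      exact absurd (YoungDiagram.mem_iff_lt_rowLen.2 hj) (YoungDiagram.notMem_bot _)
    rw [this, add_zero]
  have hcard : (attach p q ν ⊥ hl hm).card = p * q + ν.card := by
    rw [card_attach]; simp [YoungDiagram.card]
  rw [coprodCoeff, prodCoeff, hcard, card_rect, show p * q + ν.card - p * q - ν.card = 0 by omega,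
    pow_zero, one_mul, Nat.cast_eq_one, Nat.card_eq_one_iff_unique]
  constructor
  · -- Uniqueness: by degree all boxes are singletons, and the contents of the rows are forced.
    have key : ∀ T : (rect p q).cells → Finset ℕ, IsSetValuedTableau (rect p q) T →
        IsReverseLattice (word T ++ canonicalWord ν) →
        HasContent (word T ++ canonicalWord ν) (attach p q ν ⊥ hl hm) →
        ∃ t : ℕ → ℕ → ℕ, (∀ i j, i < p → j < q → box T i j = {t i j}) ∧
          ∀ i < p, ((List.range q).map (t i)).Pairwise (· ≤ ·) ∧
            ∀ k, ((List.range q).map (t i)).count k + partialContent q ν i k =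
              partialContent q ν (i + 1) k := by
      intro T hT hlat hc
      have h1 := length_eq_card_of_hasContent hc
      rw [List.length_append, length_word, length_canonicalWord, hcard] at h1
      have h2 : ∀ c, (T c).card = 1 := by
        have h3 : ∑ c : (rect p q).cells, 1 = ∑ c, (T c).card := by
          have := card_rect p q
          rw [YoungDiagram.card] at this
          rw [Finset.sum_const, Finset.card_univ, Fintype.card_coe, this, smul_eq_mul, mul_one]
          unfold degree at h1
          omega
        intro c
        exact ((Finset.sum_eq_sum_iff_of_le fun c _ => (hT.1 c).card_pos).1 h3 c
          (Finset.mem_univ c)).symm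
      have h4 : ∀ i j, ∃ a, i < p → j < q → box T i j = {a} := by
        intro i j
        by_cases h : i < p ∧ j < q
        · have hmem : (i, j) ∈ (rect p q).cells := mem_rect.2 h
          obtain ⟨a, ha⟩ := Finset.card_eq_one.1 (h2 ⟨_, hmem⟩)
          exact ⟨a, fun _ _ => (dif_pos hmem).trans ha⟩
        · exact ⟨0, fun h1 h2 => absurd ⟨h1, h2⟩ h⟩
      choose t ht using h4
      have hF := (isFilling_box.2 hT).2.1
      have hmono : ∀ i < p, ∀ j j', j ≤ j' → j' < q → t i j ≤ t i j' := by
        intro i hi j j' hjj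
        induction j', hjj using Nat.le_induction with
        | base => exact fun _ => le_rfl
        | succ j' hjj ih =>
          intro hj'
          refine (ih (by omega)).trans (hF i j' _ ?_ _ ?_)
          · simp only; rw [ht i j' hi (by omega)]; simp
          · simp only; rw [ht i (j' + 1) hi hj']; simp
      have hpair : ∀ i < p, ((List.range q).map (t i)).Pairwise (· ≤ ·) := by
        intro i hi
        rw [List.pairwise_map, List.pairwise_iff_getElem]
        intro a b ha hb hab
        simp only [List.length_range] at ha hb
        simp only [List.getElem_range]
        exact hmono i hi a b hab.le hb
      have hrow := fun i (hi : i < p) => rowWord_of_singleton ht hi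
      have hcount := count_eq_partialContent (p := p) (q := q) (ν := ν) (r := rowWord T)
        (fun i hi => by rw [hrow i hi]; exact hpair i hi)
        (fun i hi => by rw [hrow i hi]; simp)
        (by rwa [word_eq_stack, colLen_rect hq] at hlat)
        (fun k => by
          have := hc k
          rwa [word_eq_stack, colLen_rect hq, hcont] at this)
      refine ⟨t, ht, fun i hi => ⟨hpair i hi, fun k => ?_⟩⟩
      rw [← hcount i (by omega), ← hcount (i + 1) hi, ← hrow i hi, stack_succ, List.append_assoc,
        List.count_append (l₁ := rowWord T i)]
    constructor
    rintro ⟨T, hT, hlat, hc⟩ ⟨T', hT', hlat', hc'⟩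
    obtain ⟨t, ht, h⟩ := key T hT hlat hc
    obtain ⟨t', ht', h'⟩ := key T' hT' hlat' hc'
    refine Subtype.ext (box_injective ?_)
    funext ⟨i, j⟩
    by_cases hij : (i, j) ∈ (rect p q).cells
    · obtain ⟨hi, hj⟩ := mem_rect.1 hij
      have hperm : ((List.range q).map (t i)).Perm ((List.range q).map (t' i)) := by
        rw [List.perm_iff_count]
        intro k
        have h1 := (h i hi).2 k
        have h2 := (h' i hi).2 k
        omega
      have heq := hperm.eq_of_pairwise (fun a b _ _ => le_antisymm) (h i hi).1 (h' i hi).1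
      rw [List.map_inj_left] at heq
      simp only
      rw [ht i j hi hj, ht' i j hi hj, heq j (List.mem_range.2 hj)]
    · simp only [box, dif_neg hij]
  · let T : (rect p q).cells → Finset ℕ := fun c => {c.1.1 + ν.colLen (q - 1 - c.1.2)}
    have hT : ∀ i j, i < p → j < q → box T i j = {i + ν.colLen (q - 1 - j)} := fun i j hi hj =>
      dif_pos (show (i, j) ∈ (rect p q).cells from mem_rect.2 ⟨hi, hj⟩)
    have hword : word T = stack (columnRow q ν) p := by
      rw [word_eq_stack, colLen_rect hq]
      exact stack_congr fun i hi => rowWord_of_singleton hT hi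
    refine ⟨T, ⟨fun c => Finset.singleton_nonempty _, ?_, ?_⟩, ?_, ?_⟩
    · rintro ⟨⟨i, j⟩, hc⟩ ⟨⟨i', j'⟩, hd⟩ h a ha b hb
      simp only [Prod.mk.injEq, T, Finset.mem_singleton] at h ha hb
      obtain ⟨rfl, rfl⟩ := h
      rw [ha, hb]
      exact Nat.add_le_add_left (ν.colLen_anti _ _ (by omega)) _
    · rintro ⟨⟨i, j⟩, hc⟩ ⟨⟨i', j'⟩, hd⟩ h a ha b hb
      simp only [Prod.mk.injEq, T, Finset.mem_singleton] at h ha hb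
      obtain ⟨rfl, rfl⟩ := h
      omega
    · rw [hword]
      exact isReverseLattice_stack_columnRow hν p
    · intro k
      rw [hword, hcont]
      exact count_stack_columnRow hν p k

end Unit

/-! ### Weyl group invariance of representations -/

section Invariance

variable {Q₀ : Type v} {e : Q₀ → ℕ}

/-- The action of an element of the Weyl group `∏ S_{e_i}` on the index set of the characters
`L^i_j`. -/
abbrev permIndex (τ : ∀ i, Equiv.Perm (Fin (e i))) : Equiv.Perm (Σ i, Fin (e i)) :=
  Equiv.sigmaCongrRight τ

/-- The action of the Weyl group on `Rep(𝕋)`. -/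
noncomputable def permRep (τ : ∀ i, Equiv.Perm (Fin (e i))) : RepT e →+* RepT e :=
  AddMonoidAlgebra.mapDomainRingHom ℤ
    ({ toFun := fun χ s => χ ((permIndex τ).symm s)
       map_zero' := rfl
       map_add' := fun _ _ => rfl } : Weight e →+ Weight e)

theorem permRep_line (τ : ∀ i, Equiv.Perm (Fin (e i))) (χ : Weight e) :
    permRep τ (line χ) = line fun s => χ ((permIndex τ).symm s) := by
  simp [permRep, line]

/-- The matrix of a permutation, as an element of the general linear group. -/
noncomputable def permGL (A : Type*) [CommRing A] {n : ℕ} (σ : Equiv.Perm (Fin n)) :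
    GL (Fin n) A where
  val := σ.permMatrix A
  inv := σ⁻¹.permMatrix A
  val_inv := by rw [← Matrix.permMatrix_mul, inv_mul_cancel, Matrix.permMatrix_one]
  inv_val := by rw [← Matrix.permMatrix_mul, mul_inv_cancel, Matrix.permMatrix_one]

theorem diagUnits_comp_perm {A : Type*} [CommRing A] {n : ℕ} (σ : Equiv.Perm (Fin n))
    (t : Fin n → Aˣ) :
    diagUnits (fun j => t (σ j)) = permGL A σ * diagUnits t * (permGL A σ)⁻¹ := by
  rw [eq_mul_inv_iff_mul_eq]
  apply Units.ext
  simp only [Units.val_mul, diagUnits, permGL, Units.coe_map]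
  ext i j
  have h : ∀ x, (if σ x = j then if i = x then (t (σ i) : A) else 0 else 0) =
      if x = i then if σ i = j then (t j : A) else 0 else 0 := by
    intro x
    by_cases hx : x = i
    · subst hx
      by_cases h : σ x = j
      · subst h; simp
      · simp [h]
    · simp [hx, Ne.symm hx]
  simp [Matrix.mul_apply, Matrix.diagonal_apply, Equiv.Perm.permMatrix, PEquiv.toMatrix_apply,
    Equiv.toPEquiv_apply, h]

theorem coe_diagUnits {A : Type*} [CommRing A] {n : ℕ} (t : Fin n → Aˣ) :
    (diagUnits t : Matrix (Fin n) (Fin n) A) = Matrix.diagonal fun j => (t j : A) := by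
  ext i j
  simp [diagUnits, Matrix.diagonal_apply]

theorem charpoly_conj {A : Type*} [CommRing A] {n : ℕ} (P M : GL (Fin n) A) :
    (P * M * P⁻¹).val.charpoly = M.val.charpoly := by
  rw [Units.val_mul, Matrix.charpoly_mul_comm, ← Units.val_mul, inv_mul_cancel_left]

theorem charpoly_of_hasWeights {k : Type u} [Field k] [Fintype Q₀] {N : ℕ}
    {ρ : RationalRep k e N} {χ : Fin N → Weight e} (h : HasWeights ρ χ) (A : Type u) [CommRing A]
    [Algebra k A] (t : (Σ i, Fin (e i)) → Aˣ) :
    (ρ.hom A fun i => diagUnits fun j => t ⟨i, j⟩).val.charpoly =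
      ∏ m, (Polynomial.X - Polynomial.C ((∏ s, t s ^ χ m s : Aˣ) : A)) := by
  obtain ⟨P, hP⟩ := h
  rw [← Matrix.charpoly_diagonal, ← coe_diagUnits, ← hP A t, charpoly_conj]

/-- If a point `t` of the torus separates all characters, then the characteristic polynomial of
its action determines the multiset of weights (in every characteristic, unlike the trace). As
permutation matrices conjugate `t` to the permuted point, this multiset is invariant. -/
theorem weights_invariant_of_injective {k A : Type u} [Field k] [CommRing A] [IsDomain A]
    [Algebra k A] [Fintype Q₀] {N : ℕ} {ρ : RationalRep k e N} {χ : Fin N → Weight e}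
    (h : HasWeights ρ χ) (τ : ∀ i, Equiv.Perm (Fin (e i))) (t : (Σ i, Fin (e i)) → Aˣ)
    (ht : Function.Injective fun ψ : Weight e => ((∏ s, t s ^ ψ s : Aˣ) : A)) :
    Multiset.map (fun m s => χ m ((permIndex τ).symm s)) Finset.univ.val =
      Multiset.map χ Finset.univ.val := by
  have h1 := charpoly_of_hasWeights h A t
  have h2 := charpoly_of_hasWeights h A fun s => t (permIndex τ s)
  have h3 : (fun i => diagUnits fun j => t (permIndex τ ⟨i, j⟩)) =
      (fun i => permGL A (τ i)) * (fun i => diagUnits fun j => t ⟨i, j⟩) *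
        (fun i => permGL A (τ i))⁻¹ := by
    funext i
    exact diagUnits_comp_perm (τ i) fun j => t ⟨i, j⟩
  have h4 : ∀ ψ : Weight e, ∏ s, t (permIndex τ s) ^ ψ s =
      ∏ s, t s ^ ψ ((permIndex τ).symm s) := by
    intro ψ
    rw [← Equiv.prod_comp (permIndex τ) fun s => t s ^ ψ ((permIndex τ).symm s)]
    simp only [Equiv.symm_apply_apply]
  rw [h3, map_mul, map_mul, map_inv, charpoly_conj, h1] at h2
  simp only [h4] at h2
  have hr : ∀ g : Fin N → A, (∏ m, (Polynomial.X - Polynomial.C (g m))).roots =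
      Multiset.map g Finset.univ.val := fun g => by
    have := Polynomial.roots_multiset_prod_X_sub_C (Multiset.map g Finset.univ.val)
    rwa [Multiset.map_map] at this
  have h5 := congrArg Polynomial.roots h2
  rw [hr, hr] at h5
  refine Multiset.map_injective ht ?_
  rw [Multiset.map_map, Multiset.map_map]
  exact h5.symm

/-- The multiset of weights of a rational representation of `𝔾` is invariant under the Weyl
group. -/
theorem weights_invariant {k : Type u} [Field k] [Fintype Q₀] {N : ℕ}
    {ρ : RationalRep k e N} {χ : Fin N → Weight e} (h : HasWeights ρ χ)
    (τ : ∀ i, Equiv.Perm (Fin (e i))) :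
    Multiset.map (fun m s => χ m ((permIndex τ).symm s)) Finset.univ.val =
      Multiset.map χ Finset.univ.val := by
  -- The generic point of the torus. The index set is replaced by `Fin n`, so that its coordinate
  -- ring lies in the universe of `k`.
  let G := Fin (Fintype.card (Σ i, Fin (e i))) → ℤ
  let e₀ := Fintype.equivFin (Σ i, Fin (e i))
  let f : Multiplicative G →* (AddMonoidAlgebra k G)ˣ := (AddMonoidAlgebra.of k G).toHomUnits
  refine weights_invariant_of_injective (A := AddMonoidAlgebra k G) h τ
    (fun s => f (Multiplicative.ofAdd (Pi.single (e₀ s) 1))) ?_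
  have ht : ∀ ψ : Weight e, ∏ s, f (Multiplicative.ofAdd (Pi.single (e₀ s) 1)) ^ ψ s =
      f (Multiplicative.ofAdd fun i => ψ (e₀.symm i)) := by
    intro ψ
    simp only [← map_zpow, ← map_prod, ← ofAdd_zsmul, ← ofAdd_sum]
    congr 2
    funext i
    rw [Finset.sum_apply, Finset.sum_eq_single (e₀.symm i)]
    · rw [Pi.smul_apply, Equiv.apply_symm_apply, Pi.single_eq_same, smul_eq_mul, mul_one]
    · intro s _ hs
      have : i ≠ e₀ s := fun h => hs (by rw [h, Equiv.symm_apply_apply])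
      rw [Pi.smul_apply, Pi.single_eq_of_ne this, smul_zero]
    · exact fun h => absurd (Finset.mem_univ _) h
  intro ψ ψ' hψ
  simp only [ht] at hψ
  have := Multiplicative.ofAdd.injective (AddMonoidAlgebra.of_injective hψ)
  funext s
  simpa using congrFun this (e₀ s)

theorem permRep_of_mem_RepG {k : Type u} [Field k] [Fintype Q₀] {α : RepT e}
    (hα : α ∈ RepG k e) (τ : ∀ i, Equiv.Perm (Fin (e i))) : permRep τ α = α := by
  induction hα using AddSubgroup.closure_induction with
  | mem α h =>
    obtain ⟨N, ρ, χ, h, rfl⟩ := h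
    rw [map_sum]
    simp only [permRep_line]
    have := congrArg (fun s => (Multiset.map line s).sum) (weights_invariant h τ)
    simp only [Multiset.map_map, Function.comp_def] at this
    exact this
  | zero => exact map_zero _
  | add α β _ _ h1 h2 => rw [map_add, h1, h2]
  | neg α _ h => rw [map_neg, h]

end Invariance

/-! ### Power series with a lowest term -/

theorem le_weightedOrder_sum {σ ι R : Type*} [CommRing R] (w : σ → ℕ) {N : ℕ∞}
    (s : Finset ι) {f : ι → MvPowerSeries σ R} (h : ∀ i ∈ s, N ≤ (f i).weightedOrder w) :
    N ≤ (∑ i ∈ s, f i).weightedOrder w := by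
  induction s using Finset.cons_induction with
  | empty => simp
  | cons a s ha ih =>
    rw [Finset.sum_cons]
    exact le_trans (le_min (h a (by simp)) (ih fun i hi => h i (by simp [hi])))
      (MvPowerSeries.min_weightedOrder_le_add w)

section Leading

variable {σ : Type*} (w : σ → ℕ)

/-- The monomial with exponents `n` occurs in `f` with coefficient `1`, and all other terms of `f`
have larger weight. -/
def HasLowestTerm (f : MvPowerSeries σ ℤ) (n : σ →₀ ℕ) : Prop :=
  ((Finsupp.weight w n + 1 : ℕ) : ℕ∞) ≤ (f - MvPowerSeries.monomial n 1).weightedOrder w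

variable {w}

theorem HasLowestTerm.coeff_eq [DecidableEq σ] {f : MvPowerSeries σ ℤ} {n : σ →₀ ℕ}
    (h : HasLowestTerm w f n) {m : σ →₀ ℕ} (hm : Finsupp.weight w m ≤ Finsupp.weight w n) :
    MvPowerSeries.coeff m f = if m = n then 1 else 0 := by
  have h1 := MvPowerSeries.coeff_eq_zero_of_lt_weightedOrder w (d := m)
    (f := f - MvPowerSeries.monomial n 1)
    (lt_of_lt_of_le (by exact_mod_cast Nat.lt_succ_of_le hm) h)
  rw [map_sub, sub_eq_zero] at h1
  rw [h1, MvPowerSeries.coeff_monomial]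

theorem HasLowestTerm.le_weightedOrder {f : MvPowerSeries σ ℤ} {n : σ →₀ ℕ}
    (h : HasLowestTerm w f n) : ((Finsupp.weight w n : ℕ) : ℕ∞) ≤ f.weightedOrder w := by
  classical
  refine MvPowerSeries.nat_le_weightedOrder w fun d hd => ?_
  rw [h.coeff_eq hd.le, if_neg]
  rintro rfl
  exact lt_irrefl _ hd

theorem hasLowestTerm_one : HasLowestTerm w 1 0 := by
  rw [HasLowestTerm, MvPowerSeries.monomial_zero_one, sub_self, MvPowerSeries.weightedOrder_zero]
  exact le_top

theorem HasLowestTerm.mul {f g : MvPowerSeries σ ℤ} {m n : σ →₀ ℕ} (hf : HasLowestTerm w f m)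
    (hg : HasLowestTerm w g n) : HasLowestTerm w (f * g) (m + n) := by
  classical
  have e : f * g - MvPowerSeries.monomial (m + n) 1 =
      (f - MvPowerSeries.monomial m 1) * g +
        MvPowerSeries.monomial m 1 * (g - MvPowerSeries.monomial n 1) := by
    have : (MvPowerSeries.monomial (m + n) 1 : MvPowerSeries σ ℤ) =
        MvPowerSeries.monomial m 1 * MvPowerSeries.monomial n 1 := by
      rw [MvPowerSeries.monomial_mul_monomial, one_mul]
    rw [this]
    ring
  rw [HasLowestTerm, e, map_add]
  refine le_trans (le_min ?_ ?_) (MvPowerSeries.min_weightedOrder_le_add w)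
  · refine le_trans ?_ (MvPowerSeries.le_weightedOrder_mul w)
    refine le_trans ?_ (add_le_add hf hg.le_weightedOrder)
    exact_mod_cast (by omega)
  · refine le_trans ?_ (MvPowerSeries.le_weightedOrder_mul w)
    refine le_trans ?_ (add_le_add le_rfl hg)
    rw [MvPowerSeries.weightedOrder_monomial_of_ne_zero w one_ne_zero]
    exact_mod_cast (by omega)

theorem HasLowestTerm.prod {ι : Type*} (s : Finset ι) {f : ι → MvPowerSeries σ ℤ}
    {n : ι → σ →₀ ℕ} (h : ∀ i ∈ s, HasLowestTerm w (f i) (n i)) :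
    HasLowestTerm w (∏ i ∈ s, f i) (∑ i ∈ s, n i) := by
  induction s using Finset.cons_induction with
  | empty => simpa using hasLowestTerm_one
  | cons a s ha ih =>
    rw [Finset.prod_cons, Finset.sum_cons]
    exact (h a (by simp)).mul (ih fun i hi => h i (by simp [hi]))

/-- A unitriangular system of infinitely many linear equations has exactly one solution. Each
coefficient of the sum involves finitely many of the unknowns, and the coefficient at the lowest
exponent of `B ν` equals `c ν` plus a combination of the `c μ` with lowest term of smaller
weight. -/
theorem existsUnique_hasSum_smul [Finite σ] {ι : Type*} (hw : ∀ s, w s ≠ 0)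
    {B : ι → MvPowerSeries σ ℤ} {n : ι → σ →₀ ℕ} (hn : Function.Injective n)
    (hB : ∀ μ, HasLowestTerm w (B μ) (n μ)) (F : MvPowerSeries σ ℤ)
    (hF : ∀ (c : ι → ℤ) (S : MvPowerSeries σ ℤ), HasSum (fun μ => c μ • B μ) S →
      (∀ μ, MvPowerSeries.coeff (n μ) S = MvPowerSeries.coeff (n μ) F) → S = F) :
    ∃! c : ι → ℤ, HasSum (fun μ => c μ • B μ) F := by
  classical
  have hfin : ∀ N, {μ | Finsupp.weight w (n μ) ≤ N}.Finite := fun N =>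
    (Finsupp.finite_of_nat_weight_le w hw N).preimage hn.injOn
  have hzero : ∀ m μ, ¬ Finsupp.weight w (n μ) ≤ Finsupp.weight w m →
      MvPowerSeries.coeff m (B μ) = 0 := by
    intro m μ h
    rw [(hB μ).coeff_eq (not_le.1 h).le, if_neg]
    rintro rfl
    exact h le_rfl
  have hex : ∀ c : ι → ℤ, ∃ S, HasSum (fun μ => c μ • B μ) S := by
    intro c
    let S : MvPowerSeries σ ℤ := fun m => ∑ μ ∈ (hfin (Finsupp.weight w m)).toFinset,
      MvPowerSeries.coeff m (c μ • B μ)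
    refine ⟨S, MvPowerSeries.WithPiTopology.hasSum_iff_hasSum_coeff.2 fun m => ?_⟩
    refine hasSum_sum_of_ne_finset_zero fun μ hμ => ?_
    rw [map_zsmul, hzero m μ (by simpa using hμ), smul_zero]
  have hlow : ∀ ν, {μ | Finsupp.weight w (n μ) < Finsupp.weight w (n ν)}.Finite := fun ν =>
    (hfin (Finsupp.weight w (n ν))).subset fun μ hμ => by
      rw [Set.mem_ofPred_eq] at hμ ⊢
      exact hμ.le
  have hcoeff : ∀ (c : ι → ℤ) S, HasSum (fun μ => c μ • B μ) S → ∀ ν,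
      MvPowerSeries.coeff (n ν) S = c ν +
        ∑ μ ∈ (hlow ν).toFinset, c μ * MvPowerSeries.coeff (n ν) (B μ) := by
    intro c S hS ν
    rw [MvPowerSeries.WithPiTopology.hasSum_iff_hasSum_coeff] at hS
    have hν : ν ∉ (hlow ν).toFinset := by simp
    have h1 : HasSum (fun μ => MvPowerSeries.coeff (n ν) (c μ • B μ))
        (∑ μ ∈ insert ν (hlow ν).toFinset, MvPowerSeries.coeff (n ν) (c μ • B μ)) := by
      refine hasSum_sum_of_ne_finset_zero fun μ hμ => ?_
      simp only [Finset.mem_insert, Set.Finite.mem_toFinset, Set.mem_ofPred_eq, not_or,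
        not_lt] at hμ
      rw [map_zsmul, (hB μ).coeff_eq hμ.2, if_neg fun h => hμ.1 (hn h).symm, smul_zero]
    rw [(hS (n ν)).unique h1, Finset.sum_insert hν]
    simp only [map_zsmul, smul_eq_mul]
    rw [(hB ν).coeff_eq le_rfl, if_pos rfl, mul_one]
  let c : ι → ℤ := (measure fun μ => Finsupp.weight w (n μ)).wf.fix fun ν rec =>
    MvPowerSeries.coeff (n ν) F - ∑ μ ∈ (hlow ν).toFinset.attach,
      rec μ.1 ((hlow ν).mem_toFinset.1 μ.2) * MvPowerSeries.coeff (n ν) (B μ.1)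
  have hc : ∀ ν, c ν = MvPowerSeries.coeff (n ν) F -
      ∑ μ ∈ (hlow ν).toFinset, c μ * MvPowerSeries.coeff (n ν) (B μ) := by
    intro ν
    rw [← Finset.sum_attach]
    exact WellFounded.fix_eq _ _ ν
  refine ⟨c, ?_, ?_⟩
  · obtain ⟨S, hS⟩ := hex c
    have := hF c S hS fun ν => by rw [hcoeff c S hS ν, hc ν]; ring
    exact this ▸ hS
  · intro c' hc'
    funext ν
    induction ν using (measure fun μ => Finsupp.weight w (n μ)).wf.induction with
    | _ ν ih =>
      rw [hc ν, hcoeff c' F hc' ν]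
      have : ∑ μ ∈ (hlow ν).toFinset, c' μ * MvPowerSeries.coeff (n ν) (B μ) =
          ∑ μ ∈ (hlow ν).toFinset, c μ * MvPowerSeries.coeff (n ν) (B μ) :=
        Finset.sum_congr rfl fun μ hμ => by rw [ih μ ((hlow ν).mem_toFinset.1 hμ)]
      rw [this]
      ring

end Leading

/-! ### Lowest terms of stable Grothendieck polynomials -/

theorem map_stableGroth {R S : Type*} [CommRing R] [CommRing S] (φ : R →+* S)
    (μ : YoungDiagram) {p : ℕ} (a : Fin p → R) :
    φ (stableGroth μ a) = stableGroth μ fun k => φ (a k) := by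
  simp [stableGroth, map_sum, map_prod]

theorem stableGroth_bot {R : Type*} [CommRing R] {p : ℕ} (a : Fin p → R) :
    stableGroth ⊥ a = 1 := by
  have : IsEmpty (⊥ : YoungDiagram).cells := ⟨fun c => YoungDiagram.notMem_bot _ c.2⟩
  have h : ∀ T : (⊥ : YoungDiagram).cells → Finset (Fin p), IsSetValuedTableau ⊥ T := fun T =>
    ⟨fun c => isEmptyElim c, fun c => isEmptyElim c, fun c => isEmptyElim c⟩
  classical
  rw [stableGroth, Finset.filter_true_of_mem fun T _ => h T, Fintype.sum_unique]
  simp [degree]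

theorem row_lt_colLen {μ : YoungDiagram} (c : μ.cells) : c.1.1 < μ.colLen 0 :=
  YoungDiagram.mem_iff_lt_colLen.1 (μ.up_left_mem le_rfl (Nat.zero_le _) c.2)

theorem le_of_mem_isFilling {μ : YoungDiagram} {p : ℕ} {F : ℕ × ℕ → Finset (Fin p)}
    (hF : IsFilling μ F) (i : ℕ) : ∀ j, ∀ k ∈ F (i, j), i ≤ k.1 := by
  induction i with
  | zero => exact fun _ _ _ => Nat.zero_le _
  | succ i ih =>
    intro j k hk
    obtain ⟨a, ha⟩ := (hF.1 (i, j)).2 (μ.up_left_mem (Nat.le_succ i) le_rfl ((hF.1 _).1 ⟨k, hk⟩))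
    exact lt_of_le_of_lt (ih j a ha) (hF.2.2 i j a ha k hk)

/-- Letters are at least as large as the index of their row. -/
theorem IsSetValuedTableau.row_le {μ : YoungDiagram} {p : ℕ} {T : μ.cells → Finset (Fin p)}
    (hT : IsSetValuedTableau μ T) (c : μ.cells) {k : Fin p} (hk : k ∈ T c) : c.1.1 ≤ k.1 := by
  rw [← box_val T c] at hk
  exact le_of_mem_isFilling (isFilling_box.2 hT) c.1.1 c.1.2 k hk

section

variable {G : ℕ → ℕ} {μ : YoungDiagram} {p : ℕ} {T : μ.cells → Finset (Fin p)}

theorem IsSetValuedTableau.rowWeight_le (hG : StrictMono G) (hT : IsSetValuedTableau μ T)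
    (c : μ.cells) : G c.1.1 ≤ ∑ k ∈ T c, G k := by
  obtain ⟨k, hk⟩ := hT.1 c
  exact (hG.monotone (hT.row_le c hk)).trans
    (Finset.single_le_sum (f := fun k : Fin p => G k) (fun _ _ => Nat.zero_le _) hk)

theorem IsSetValuedTableau.sum_rowWeight_le (hG : StrictMono G) (hT : IsSetValuedTableau μ T) :
    ∑ c : μ.cells, G c.1.1 ≤ ∑ c, ∑ k ∈ T c, G k :=
  Finset.sum_le_sum fun c _ => hT.rowWeight_le hG c

/-- The tableau of least weight has the letter `i` in all boxes of row `i`. -/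
theorem IsSetValuedTableau.eq_of_sum_le (hG : StrictMono G) (hT : IsSetValuedTableau μ T)
    (h : ∑ c, ∑ k ∈ T c, G k ≤ ∑ c : μ.cells, G c.1.1) (c : μ.cells) {k : Fin p}
    (hk : k ∈ T c) : k.1 = c.1.1 := by
  have h1 := (Finset.sum_eq_sum_iff_of_le fun c _ => hT.rowWeight_le hG c).1
    (le_antisymm (hT.sum_rowWeight_le hG) h) c (Finset.mem_univ c)
  have h2 : G k ≤ G c.1.1 := by
    rw [h1]
    exact Finset.single_le_sum (f := fun k : Fin p => G k) (fun _ _ => Nat.zero_le _) hk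
  exact le_antisymm (hG.le_iff_le.1 h2) (hT.row_le c hk)

end

section Order

variable {σ : Type*} {w : σ → ℕ} {μ : YoungDiagram} {p : ℕ}

theorem le_weightedOrder_term {α : Type*} (T : μ.cells → Finset α) {a : α → MvPowerSeries σ ℤ}
    {b : α → ℕ} (ha : ∀ k, (b k : ℕ∞) ≤ (a k).weightedOrder w) (n : ℕ) :
    ((∑ c, ∑ k ∈ T c, b k : ℕ) : ℕ∞) ≤
      ((-1) ^ n * ∏ c, ∏ k ∈ T c, a k).weightedOrder w := by
  refine le_trans ?_ (MvPowerSeries.le_weightedOrder_mul w)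
  refine le_trans ?_ le_add_self
  refine le_trans ?_ (MvPowerSeries.le_weightedOrder_prod w _ _)
  rw [Nat.cast_sum]
  refine Finset.sum_le_sum fun c _ => ?_
  refine le_trans ?_ (MvPowerSeries.le_weightedOrder_prod w _ _)
  rw [Nat.cast_sum]
  exact Finset.sum_le_sum fun k _ => ha k

theorem le_weightedOrder_stableGroth {a : Fin p → MvPowerSeries σ ℤ} {b : Fin p → ℕ}
    (ha : ∀ k, (b k : ℕ∞) ≤ (a k).weightedOrder w) {N : ℕ}
    (h : ∀ T : μ.cells → Finset (Fin p), IsSetValuedTableau μ T → N ≤ ∑ c, ∑ k ∈ T c, b k) :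
    (N : ℕ∞) ≤ (stableGroth μ a).weightedOrder w := by
  classical
  refine le_weightedOrder_sum w _ fun T hT => ?_
  refine le_trans ?_ (le_weightedOrder_term T ha _)
  exact_mod_cast h T (by simpa using hT)

theorem card_mul_le_weightedOrder_stableGroth {a : Fin p → MvPowerSeries σ ℤ} {b : ℕ}
    (ha : ∀ k, (b : ℕ∞) ≤ (a k).weightedOrder w) :
    ((μ.card * b : ℕ) : ℕ∞) ≤ (stableGroth μ a).weightedOrder w := by
  refine le_weightedOrder_stableGroth (b := fun _ => b) ha fun T hT => ?_
  simp only [Finset.sum_const, smul_eq_mul, ← Finset.sum_mul]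
  exact Nat.mul_le_mul_right b (card_le_degree hT)

theorem weightedOrder_X_ge (s : σ) :
    (w s : ℕ∞) ≤ (MvPowerSeries.X s : MvPowerSeries σ ℤ).weightedOrder w := by
  rw [MvPowerSeries.X, MvPowerSeries.weightedOrder_monomial_of_ne_zero w one_ne_zero]
  simp [Finsupp.weight_apply]

/-- The exponent `∑_i μ_i s_i`, where `s i` is the variable attached to the letter `i`. -/
noncomputable def rowExponent (s : Fin p → σ) (μ : YoungDiagram) (h : μ.colLen 0 ≤ p) : σ →₀ ℕ :=
  ∑ c : μ.cells, Finsupp.single (s ⟨c.1.1, (row_lt_colLen c).trans_le h⟩) 1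

variable {G : ℕ → ℕ} {s : Fin p → σ}

theorem weight_rowExponent (hs : ∀ k, w (s k) = G k) (h : μ.colLen 0 ≤ p) :
    Finsupp.weight w (rowExponent s μ h) = ∑ c : μ.cells, G c.1.1 := by
  rw [rowExponent, map_sum]
  refine Finset.sum_congr rfl fun c _ => ?_
  simp [Finsupp.weight_apply, hs]

/-- The lowest term of a stable Grothendieck polynomial, for weights that increase with the
letters. -/
theorem hasLowestTerm_stableGroth (hG : StrictMono G) (hs : ∀ k, w (s k) = G k)
    (h : μ.colLen 0 ≤ p) :
    HasLowestTerm w (stableGroth μ fun k => MvPowerSeries.X (s k)) (rowExponent s μ h) := by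
  classical
  let r : μ.cells → Fin p := fun c => ⟨c.1.1, (row_lt_colLen c).trans_le h⟩
  let T₀ : μ.cells → Finset (Fin p) := fun c => {r c}
  have hT₀ : IsSetValuedTableau μ T₀ := by
    refine ⟨fun c => Finset.singleton_nonempty _, fun c d hcd a ha b hb => ?_,
      fun c d hcd a ha b hb => ?_⟩
    all_goals
      rw [Finset.mem_singleton] at ha hb
      subst ha hb
      simp [r, hcd]
  have hterm : (-1) ^ (degree T₀ - μ.card) * ∏ c, ∏ k ∈ T₀ c, MvPowerSeries.X (s k) =
      (MvPowerSeries.monomial (rowExponent s μ h) 1 : MvPowerSeries σ ℤ) := by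
    have h1 : degree T₀ - μ.card = 0 := by simp [degree, T₀, YoungDiagram.card]
    rw [h1, pow_zero, one_mul]
    simp only [T₀, Finset.prod_singleton, MvPowerSeries.X]
    rw [MvPowerSeries.prod_monomial, Finset.prod_const_one]
    rfl
  rw [HasLowestTerm, stableGroth, ← Finset.add_sum_erase _ _ (a := T₀) (by simpa using hT₀), hterm,
    add_sub_cancel_left]
  refine le_weightedOrder_sum w _ fun T hT => ?_
  simp only [Finset.mem_erase, Finset.mem_filter, Finset.mem_univ, true_and] at hT
  refine le_trans ?_ (le_weightedOrder_term T (b := fun k => G k)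
    (fun k => by rw [← hs]; exact weightedOrder_X_ge (s k)) _)
  rw [weight_rowExponent hs, Nat.cast_le, Nat.succ_le_iff]
  by_contra! hle
  refine hT.1 (funext fun c => ?_)
  refine Finset.eq_singleton_iff_nonempty_unique_mem.2 ⟨hT.2.1 c, fun k hk => ?_⟩
  exact Fin.ext (hT.2.eq_of_sum_le hG hle c hk)

theorem le_weightedOrder_stableGroth_X (hG : StrictMono G) (hs : ∀ k, w (s k) = G k) :
    ((∑ c : μ.cells, G c.1.1 : ℕ) : ℕ∞) ≤
      (stableGroth μ fun k => (MvPowerSeries.X (s k) : MvPowerSeries σ ℤ)).weightedOrder w :=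
  le_weightedOrder_stableGroth (fun k => (hs k ▸ weightedOrder_X_ge (s k) : ((G k : ℕ) : ℕ∞) ≤ _))
    fun _ hT => hT.sum_rowWeight_le hG

end Order

section Torus

variable {Q₀ : Type v} {e : Q₀ → ℕ} [Fintype Q₀]

theorem coe_oneSubX {Q₀ : Type v} {e : Q₀ → ℕ} (s : Σ i, Fin (e i)) :
    (oneSubX s : MvPowerSeries (Σ i, Fin (e i)) ℤ) = 1 - MvPowerSeries.X s := rfl

theorem toPowerSeries_line (χ : Weight e) : toPowerSeries (line χ) =
    ((∏ s, oneSubX s ^ (-χ s) : (MvPowerSeries (Σ i, Fin (e i)) ℤ)ˣ) :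
      MvPowerSeries (Σ i, Fin (e i)) ℤ) := by
  simp only [toPowerSeries, line, AlgHom.toRingHom_eq_coe, RingHom.coe_coe,
    AddMonoidAlgebra.lift_single]
  exact one_smul ℤ _

theorem prod_oneSubX_zpow_vertexRep (i : Q₀) (j : Fin (e i)) :
    ∏ s, oneSubX s ^ vertexRep e i j s = oneSubX ⟨i, j⟩ := by
  classical
  rw [Finset.prod_eq_single ⟨i, j⟩]
  · simp [vertexRep]
  · intro s _ hs
    rw [vertexRep, Pi.single_eq_of_ne hs, zpow_zero]
  · exact fun h => absurd (Finset.mem_univ _) h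

theorem toPowerSeries_one_sub_line_neg (i : Q₀) (j : Fin (e i)) :
    toPowerSeries (1 - line (-vertexRep e i j)) = MvPowerSeries.X ⟨i, j⟩ := by
  rw [map_sub, map_one, toPowerSeries_line]
  simp only [Pi.neg_apply, neg_neg]
  rw [prod_oneSubX_zpow_vertexRep, coe_oneSubX, sub_sub_cancel]

theorem le_weightedOrder_one_sub_line {w : (Σ i, Fin (e i)) → ℕ} (i : Q₀) (j : Fin (e i)) :
    (w ⟨i, j⟩ : ℕ∞) ≤ (toPowerSeries (1 - line (vertexRep e i j))).weightedOrder w := by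
  have h : toPowerSeries (1 - line (vertexRep e i j)) =
      -MvPowerSeries.X ⟨i, j⟩ * (((oneSubX ⟨i, j⟩)⁻¹ : (MvPowerSeries (Σ i, Fin (e i)) ℤ)ˣ) :
        MvPowerSeries (Σ i, Fin (e i)) ℤ) := by
    rw [map_sub, map_one, toPowerSeries_line]
    simp only [zpow_neg, Finset.prod_inv_distrib]
    rw [prod_oneSubX_zpow_vertexRep, Units.eq_mul_inv_iff_mul_eq, sub_mul, one_mul, Units.inv_mul,
      coe_oneSubX]
    ring
  rw [h]
  refine le_trans ?_ (MvPowerSeries.le_weightedOrder_mul w)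
  rw [MvPowerSeries.weightedOrder_neg]
  exact (weightedOrder_X_ge (w := w) (⟨i, j⟩ : Σ i, Fin (e i))).trans le_self_add

theorem sum_rowWeight_le_add {G : ℕ → ℕ} {W : ℕ} {lam ν : YoungDiagram} (h : lam ≤ ν)
    (hW : ∀ i < ν.colLen 0, G i < W) :
    ∑ c : ν.cells, G c.1.1 + (ν.card - lam.card) ≤
      ∑ c : lam.cells, G c.1.1 + (ν.card - lam.card) * W := by
  classical
  have hsub := YoungDiagram.cells_subset_iff.2 h
  rw [Finset.sum_coe_sort ν.cells fun c => G c.1, Finset.sum_coe_sort lam.cells fun c => G c.1,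
    ← Finset.sum_sdiff hsub]
  have h1 : ∑ c ∈ ν.cells \ lam.cells, (G c.1 + 1) ≤ ∑ _c ∈ ν.cells \ lam.cells, W :=
    Finset.sum_le_sum fun c hc =>
      hW _ (row_lt_colLen (⟨c, (Finset.mem_sdiff.1 hc).1⟩ : ν.cells))
  rw [Finset.sum_add_distrib, Finset.sum_const, Finset.sum_const, smul_eq_mul, smul_eq_mul,
    Finset.card_sdiff_of_subset hsub] at h1
  simp only [YoungDiagram.card]
  omega

variable [Quiver Q₀] [∀ i j : Q₀, Fintype (i ⟶ j)]

/-- If the variables at the tails of the arrows to `i` have larger weights than the variables at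
`i`, then `𝒢_ν(E_i - M_i)` and `𝒢_ν(E_i)` have the same lowest term. -/
theorem hasLowestTerm_grothDiff {w : (Σ i, Fin (e i)) → ℕ} {i : Q₀} {G : ℕ → ℕ} {W : ℕ}
    (hG : StrictMono G) (hw : ∀ j, w ⟨i, j⟩ = G j) (hW₀ : 0 < W)
    (hW : ∀ j < e i, G j < W)
    (hM : ∀ j : Q₀, Nonempty (j ⟶ i) → ∀ m, W ≤ w ⟨j, m⟩) {ν : YoungDiagram}
    (h : ν.colLen 0 ≤ e i) :
    HasLowestTerm w (toPowerSeries (grothDiff ν (vertexRep e i) (tailRep e i)))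
      (rowExponent (fun j => (⟨i, j⟩ : Σ i, Fin (e i))) ν h) := by
  classical
  have h₁ : ∀ lam, toPowerSeries (grothRep lam (vertexRep e i)) =
      stableGroth lam fun j => MvPowerSeries.X ⟨i, j⟩ := fun lam => by
    rw [grothRep, map_stableGroth]
    simp only [toPowerSeries_one_sub_line_neg]
  have h₂ : ∀ μ : YoungDiagram, ((μ.card * W : ℕ) : ℕ∞) ≤
      (toPowerSeries (grothRep μ.transpose fun m => -tailRep e i m)).weightedOrder w := by
    intro μ
    rw [grothRep, map_stableGroth]
    have hcard : μ.transpose.card = μ.card := by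
      simp [YoungDiagram.card, YoungDiagram.transpose]
    rw [← hcard]
    refine card_mul_le_weightedOrder_stableGroth fun m => ?_
    rw [neg_neg]
    refine le_trans ?_ (le_weightedOrder_one_sub_line _ _)
    exact_mod_cast hM _ ⟨((Fintype.equivFin (TailIndex e i)).symm m).2.1⟩ _
  have hlow := hasLowestTerm_stableGroth (μ := ν) hG hw h
  rw [HasLowestTerm, weight_rowExponent hw] at hlow ⊢
  let x₀ : Set.Iic ν × Set.Iic ν := (⟨ν, le_refl ν⟩, ⟨⊥, Set.mem_Iic.2 bot_le⟩)
  rw [grothDiff, ← Finset.sum_product', map_sum,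
    ← Finset.add_sum_erase _ _ (a := x₀) (by simp)]
  have hx₀ : coprodCoeff (ν.colLen 0) (ν.rowLen 0) ν x₀.1 x₀.2 (le_trans x₀.1.2 (le_rect ν))
      (le_trans x₀.2.2 (le_rect ν)) = 1 := by
    refine coprodCoeff_self_bot ?_ _ _
    by_cases h0 : ν.colLen 0 = 0
    · exact Or.inr h0
    · refine Or.inl (YoungDiagram.mem_iff_lt_rowLen.1 ?_)
      exact YoungDiagram.mem_iff_lt_colLen.2 (Nat.pos_of_ne_zero h0)
  have hbot : (⊥ : YoungDiagram).transpose = ⊥ := by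
    rw [YoungDiagram.transpose_eq_iff_eq_transpose]
    ext c
    simp
  rw [hx₀, one_smul, map_mul, h₁]
  simp only [x₀, hbot]
  rw [grothRep, stableGroth_bot, map_one, mul_one, add_sub_right_comm]
  refine le_trans (le_min hlow ?_) (MvPowerSeries.min_weightedOrder_le_add w)
  refine le_weightedOrder_sum w _ ?_
  rintro ⟨⟨lam, hlam⟩, ⟨μ, hμ⟩⟩ hx
  by_cases hd : coprodCoeff (ν.colLen 0) (ν.rowLen 0) ν lam μ (le_trans hlam (le_rect ν))
      (le_trans hμ (le_rect ν)) = 0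
  · simp only [hd, zero_smul, map_zero, MvPowerSeries.weightedOrder_zero]
    exact le_top
  have hcard := card_le_of_coprodCoeff_ne_zero hd
  have hpos : 0 < μ.card := by
    by_contra! h0
    have hμ0 : μ = ⊥ := YoungDiagram.ext (by simpa [YoungDiagram.card] using h0)
    have hlν : lam = ν := by
      refine YoungDiagram.ext (Finset.eq_of_subset_of_card_le
        (YoungDiagram.cells_subset_iff.2 hlam) ?_)
      change ν.card ≤ lam.card
      omega
    exact (Finset.mem_erase.1 hx).1 (by simp only [hμ0, hlν])
  have hW0 : ∑ c : ν.cells, G c.1.1 + 1 ≤ ∑ c : lam.cells, G c.1.1 + μ.card * W := by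
    have h3 := sum_rowWeight_le_add (G := G) (W := W) hlam fun i hi => hW i (hi.trans_le h)
    have h4 : (ν.card - lam.card) * W ≤ μ.card * W := Nat.mul_le_mul_right W (by omega)
    rcases Nat.eq_zero_or_pos (ν.card - lam.card) with h5 | h5
    · rw [h5] at h3
      have := Nat.mul_pos hpos hW₀
      omega
    · omega
  rw [map_zsmul]
  refine le_trans ?_ (MvPowerSeries.le_weightedOrder_smul w)
  rw [map_mul, h₁]
  refine le_trans ?_ (MvPowerSeries.le_weightedOrder_mul w)
  refine le_trans ?_ (add_le_add (le_weightedOrder_stableGroth_X hG hw) (h₂ μ))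
  exact_mod_cast hW0

end Torus

/-! ### Weyl group invariance of power series -/

section Symmetric

variable {Q₀ : Type v} {e : Q₀ → ℕ}

/-- By the symmetry of stable Grothendieck polynomials, `𝒢_ν(U)` is invariant under the Weyl group
if the summands of `U` are only permuted. -/
theorem permRep_grothRep (τ : ∀ i, Equiv.Perm (Fin (e i))) (ν : YoungDiagram) {p : ℕ}
    (U : Fin p → Weight e) (σ : Equiv.Perm (Fin p))
    (h : ∀ m, (fun s => U m ((permIndex τ).symm s)) = U (σ m)) :
    permRep τ (grothRep ν U) = grothRep ν U := by
  rw [grothRep, map_stableGroth, ← stableGroth_comp_perm ν (fun m => 1 - line (-U m)) σ]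
  congr 1
  funext m
  rw [map_sub, map_one, permRep_line, Function.comp_apply, ← h m]
  rfl

theorem vertexRep_comp_symm (τ : ∀ i, Equiv.Perm (Fin (e i))) (i : Q₀) (j : Fin (e i)) :
    (fun s => vertexRep e i j ((permIndex τ).symm s)) = vertexRep e i (τ i j) := by
  classical
  funext s
  have h : (permIndex τ).symm s = ⟨i, j⟩ ↔ s = ⟨i, τ i j⟩ := by
    rw [Equiv.symm_apply_eq]; rfl
  simp only [vertexRep, Pi.single_apply, h]

theorem permRep_grothDiff [Fintype Q₀] [Quiver.{w} Q₀] [∀ i j : Q₀, Fintype (i ⟶ j)]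
    (τ : ∀ i, Equiv.Perm (Fin (e i))) (ν : YoungDiagram) (i : Q₀) :
    permRep τ (grothDiff ν (vertexRep e i) (tailRep e i)) =
      grothDiff ν (vertexRep e i) (tailRep e i) := by
  -- The Weyl group permutes the summands of `M_i`.
  let π : Equiv.Perm (TailIndex e i) :=
    Equiv.sigmaCongrRight fun j => (Equiv.refl (j ⟶ i)).prodCongr (τ j)
  let σ : Equiv.Perm (Fin (Fintype.card (TailIndex e i))) :=
    ((Fintype.equivFin (TailIndex e i)).symm.trans π).trans (Fintype.equivFin (TailIndex e i))
  have hσ : ∀ m, (fun s => tailRep e i m ((permIndex τ).symm s)) = tailRep e i (σ m) := by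
    intro m
    let V : TailIndex e i → Weight e := fun s => vertexRep e s.1 s.2.2
    change _ = V ((Fintype.equivFin (TailIndex e i)).symm (Fintype.equivFin (TailIndex e i)
      (π ((Fintype.equivFin (TailIndex e i)).symm m))))
    rw [Equiv.symm_apply_apply]
    exact vertexRep_comp_symm τ _ _
  rw [grothDiff, map_sum]
  refine Finset.sum_congr rfl fun lam _ => ?_
  rw [map_sum]
  refine Finset.sum_congr rfl fun μ _ => ?_
  rw [map_zsmul, map_mul, permRep_grothRep τ _ _ (τ i) (vertexRep_comp_symm τ i),
    permRep_grothRep τ _ _ σ]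
  intro m
  rw [← hσ]
  rfl

variable [Fintype Q₀]

theorem toPowerSeries_permRep (τ : ∀ i, Equiv.Perm (Fin (e i))) (α : RepT e) :
    toPowerSeries (permRep τ α) =
      MvPowerSeries.rename (permIndex τ).toEmbedding (toPowerSeries α) := by
  let φ : MvPowerSeries (Σ i, Fin (e i)) ℤ →+* MvPowerSeries (Σ i, Fin (e i)) ℤ :=
    (MvPowerSeries.rename (permIndex τ).toEmbedding :
      MvPowerSeries (Σ i, Fin (e i)) ℤ →ₐ[ℤ] MvPowerSeries (Σ i, Fin (e i)) ℤ)
  have hφ : ∀ s, Units.map φ.toMonoidHom (oneSubX s) = oneSubX (permIndex τ s) := by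
    intro s
    apply Units.ext
    change φ (1 - MvPowerSeries.X s) = 1 - MvPowerSeries.X _
    rw [map_sub, map_one]
    exact congrArg _ (MvPowerSeries.rename_X _ s)
  have key : (toPowerSeries.comp (permRep τ) : RepT e →+* _) = φ.comp toPowerSeries := by
    refine AddMonoidAlgebra.ringHom_ext (fun r => ?_) fun χ => ?_
    · have : (AddMonoidAlgebra.single 0 r : RepT e) = (r : RepT e) := by
        simp [AddMonoidAlgebra.intCast_def]
      rw [this, map_intCast, map_intCast]
    · change toPowerSeries (permRep τ (line χ)) = φ (toPowerSeries (line χ))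
      rw [permRep_line, toPowerSeries_line, toPowerSeries_line]
      change _ = (Units.map φ.toMonoidHom (∏ s, oneSubX s ^ (-χ s))).val
      rw [map_prod]
      simp only [map_zpow, hφ]
      rw [← Equiv.prod_comp (permIndex τ)]
      simp only [Equiv.symm_apply_apply]
  exact RingHom.congr_fun key α

theorem coeff_embDomain_toPowerSeries {τ : ∀ i, Equiv.Perm (Fin (e i))} {α : RepT e}
    (h : permRep τ α = α) (m : (Σ i, Fin (e i)) →₀ ℕ) :
    MvPowerSeries.coeff (m.embDomain (permIndex τ).toEmbedding) (toPowerSeries α) =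
      MvPowerSeries.coeff m (toPowerSeries α) := by
  conv_lhs => rw [← h, toPowerSeries_permRep]
  exact MvPowerSeries.coeff_embDomain_rename (permIndex τ).toEmbedding (toPowerSeries α) m

end Symmetric

/-! ### Exponents and families of partitions -/

section Exponents

variable {Q₀ : Type v} [Fintype Q₀] {e : Q₀ → ℕ}

/-- The exponent of `∏_{i,j} (x^i_j)^{μ_{i,j}}`, where `μ_{i,j}` is the `j`-th part of `μ_i`. -/
noncomputable def familyExponent (μ : (i : Q₀) → {μ : YoungDiagram // μ.colLen 0 ≤ e i}) :
    (Σ i, Fin (e i)) →₀ ℕ :=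
  ∑ i, rowExponent (fun j => (⟨i, j⟩ : Σ i, Fin (e i))) (μ i).1 (μ i).2

theorem familyExponent_apply (μ : (i : Q₀) → {μ : YoungDiagram // μ.colLen 0 ≤ e i}) (i : Q₀)
    (j : Fin (e i)) : familyExponent μ ⟨i, j⟩ = (μ i).1.rowLen j := by
  classical
  rw [familyExponent, Finset.sum_apply', Finset.sum_eq_single i]
  · rw [rowExponent, Finset.sum_apply', YoungDiagram.rowLen_eq_card, YoungDiagram.row,
      Finset.card_filter, ← Finset.sum_coe_sort (μ i).1.cells]
    refine Finset.sum_congr rfl fun c _ => ?_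
    rw [Finsupp.single_apply]
    refine if_congr ?_ rfl rfl
    simp [Fin.ext_iff]
  · intro i' _ hi'
    rw [rowExponent, Finset.sum_apply']
    refine Finset.sum_eq_zero fun c _ => Finsupp.single_eq_of_ne ?_
    intro h
    exact hi' (congrArg Sigma.fst h).symm
  · exact fun h => absurd (Finset.mem_univ i) h

theorem familyExponent_injective : Function.Injective (familyExponent (e := e)) := by
  intro μ μ' h
  funext i
  refine Subtype.ext (eq_of_rowLen_eq fun r => ?_)
  by_cases hr : r < e i
  · have := DFunLike.congr_fun h ⟨i, ⟨r, hr⟩⟩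
    rwa [familyExponent_apply, familyExponent_apply] at this
  · rw [rowLen_eq_zero_iff.2 ((μ i).2.trans (not_lt.1 hr)),
      rowLen_eq_zero_iff.2 ((μ' i).2.trans (not_lt.1 hr))]

/-- Every exponent is, up to the Weyl group, given by a family of partitions. -/
theorem exists_eq_embDomain_familyExponent (m : (Σ i, Fin (e i)) →₀ ℕ) :
    ∃ (τ : ∀ i, Equiv.Perm (Fin (e i))) (μ : (i : Q₀) → {μ : YoungDiagram // μ.colLen 0 ≤ e i}),
      m = (familyExponent μ).embDomain (permIndex τ).toEmbedding := by
  let τ : ∀ i, Equiv.Perm (Fin (e i)) := fun i =>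
    Tuple.sort fun j => OrderDual.toDual (m ⟨i, j⟩)
  have hτ : ∀ i, Antitone fun j => m ⟨i, τ i j⟩ := fun i =>
    Tuple.monotone_sort fun j => OrderDual.toDual (m ⟨i, j⟩)
  let f : Q₀ → ℕ → ℕ := fun i r => if h : r < e i then m ⟨i, τ i ⟨r, h⟩⟩ else 0
  have hf : ∀ i, Antitone (f i) := by
    intro i a b hab
    simp only [f]
    split_ifs with h1 h2 h2
    · exact hτ i hab
    · omega
    · exact Nat.zero_le _
    · exact le_rfl
  have hf0 : ∀ i r, e i ≤ r → f i r = 0 := fun i r hr => dif_neg (not_lt.2 hr)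
  refine ⟨τ, fun i => ⟨diagramOfRows (f i) (hf i) (e i), ?_⟩, ?_⟩
  · rw [← rowLen_eq_zero_iff, rowLen_diagramOfRows (hf i) (hf0 i), hf0 i _ le_rfl]
  · ext s
    obtain ⟨⟨i, j⟩, rfl⟩ := (permIndex τ).surjective s
    refine Eq.trans ?_ (Finsupp.embDomain_apply_self (permIndex τ).toEmbedding _ ⟨i, j⟩).symm
    rw [familyExponent_apply, rowLen_diagramOfRows (hf i) (hf0 i)]
    simp only [f, dif_pos j.2]
    rfl

end Exponents

/-- In a quiver without oriented cycles the number of vertices that can be reached decreases along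
arrows. -/
theorem card_reachable_lt {Q₀ : Type v} [Finite Q₀] [Quiver.{w} Q₀]
    (hQ : ∀ (i : Q₀) (p : Quiver.Path i i), p.length = 0) {i j : Q₀} (a : j ⟶ i) :
    {k | Nonempty (Quiver.Path i k)}.ncard < {k | Nonempty (Quiver.Path j k)}.ncard := by
  refine Set.ncard_lt_ncard ⟨?_, fun h => ?_⟩
  · rintro k ⟨p⟩
    exact ⟨a.toPath.comp p⟩
  · obtain ⟨p⟩ := h (show j ∈ {k | Nonempty (Quiver.Path j k)} from ⟨Quiver.Path.nil⟩)
    have := hQ j (a.toPath.comp p)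
    simp at this

end QuiverCoeff

theorem proposition3p1 {k : Type*} [Field k] {Q₀ : Type*} [Fintype Q₀] [Quiver Q₀]
    [∀ i j : Q₀, Fintype (i ⟶ j)]
    (hQ : ∀ (i : Q₀) (p : Quiver.Path i i), p.length = 0)
    (e : Q₀ → ℕ) (α : RepT e) (hα : α ∈ RepG k e) :
    ∃! c : ((i : Q₀) → {μ : YoungDiagram // μ.colLen 0 ≤ e i}) → ℤ,
      HasSum (fun μ => c μ • toPowerSeries (∏ i, grothDiff (μ i).1 (vertexRep e i) (tailRep e i)))
        (toPowerSeries α) := by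
  let d : Q₀ → ℕ := fun i => {k | Nonempty (Quiver.Path i k)}.ncard
  let E := ∑ i, e i
  have hE : ∀ i, e i ≤ E := fun i => Finset.single_le_sum (fun _ _ => Nat.zero_le _)
    (Finset.mem_univ i)
  -- Positive weights that increase with the index of the variable at each vertex, and such that
  -- the tail of an arrow has larger weights than its head.
  let w : (Σ i, Fin (e i)) → ℕ := fun s => d s.1 * E + s.2 + 1
  refine existsUnique_hasSum_smul (w := w) (fun s => Nat.succ_ne_zero _) familyExponent_injective
    (fun μ => ?_) _ fun c S hS h => ?_
  · rw [map_prod]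
    refine HasLowestTerm.prod _ fun i _ =>
      hasLowestTerm_grothDiff (G := fun r => d i * E + r + 1) (W := d i * E + E + 1)
        (fun a b hab => by simp only; omega) (fun j => rfl) (Nat.succ_pos _)
        (fun j hj => by have := hE i; omega) ?_ (μ i).2
    rintro j ⟨a⟩ m
    have h1 : (d i + 1) * E ≤ d j * E := Nat.mul_le_mul_right E (card_reachable_lt hQ a)
    rw [Nat.succ_mul] at h1
    simp only [w]
    omega
  · -- Both sides are symmetric, so it suffices to compare coefficients at families of partitions.
    ext m
    obtain ⟨τ, μ, rfl⟩ := exists_eq_embDomain_familyExponent m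
    rw [coeff_embDomain_toPowerSeries (permRep_of_mem_RepG hα τ), ← h μ]
    rw [MvPowerSeries.WithPiTopology.hasSum_iff_hasSum_coeff] at hS
    refine (hS _).unique ?_
    convert hS (familyExponent μ) using 2 with ν
    rw [map_zsmul, map_zsmul, coeff_embDomain_toPowerSeries]
    rw [map_prod]
    exact Finset.prod_congr rfl fun i _ => permRep_grothDiff τ _ i
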